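/- \textbf{The system.} Let $h,g,\lambda$ be real constants with $\lambda\neq 0$. The PVTOL control system is $$\ddot x=-u_1\sin\theta+h\,u_2\cos\theta,\qquad \ddot z=u_1\cos\theta+h\,u_2\sin\theta-g,\qquad \ddot\theta=\lambda u_2,$$ with the six state variables $(x,\dot x,z,\dot z,\theta,\dot\theta)$ and the controls $(u_1,u_2)$. Writing it as a first-order system $\dot{\mathbf x}=f(t,\mathbf x,u)$, let $M\subseteq\mathbb R\times\mathbb R^6\times\mathbb R^2$ be a non-empty open set and let $\mathcal V=\mathrm{span}\{\partial_t+\sum_i f^i\partial_{\mathbf x^i},\partial_{u_1},\partial_{u_2}\}\subset TM$ be the rank 3 distribution representing the system. \textbf{The group.} Let $H$ be a 1-parameter Lie transformation group of $M$ (a smooth action of $(\mathbb R,+)$ on $M$), with infinitesimal generator $X_H$ and $\Gamma=\mathrm{span}\{X_H\}$, that is control admissible for $\mathcal V$: every element of $H$ preserves $\mathcal V$ and the function $t$; the projection of $\Gamma$ under $(t,\mathbf x,u)\mapsto(t,\mathbf x)$ has rank $1$ at every point; $\Gamma\cap\mathcal V^{(1)}=0$, where $\mathcal V^{(1)}=\mathcal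 V+[\mathcal V,\mathcal V]$; and $H$ acts regularly, so that the orbit space $M/H$ is a smooth $8$-dimensional manifold and $\pi:M\to M/H$ is a smooth surjective submersion. Put $\mathcal V/H:=d\pi(\mathcal V)$. \textbf{Goursat bundles.} For a smooth sub-bundle $\mathcal D$ of the tangent bundle of a manifold $N$ put $\mathcal D^{(0)}=\mathcal D$ and $\mathcal D^{(j+1)}=\mathcal D^{(j)}+[\mathcal D^{(j)},\mathcal D^{(j)}]$. The derived length $k$ is the smallest integer with $\mathcal D^{(k)}=\mathcal D^{(k+1)}$. Let $\mathrm{Char}\,\mathcal D^{(j)}=\mathrm{span}\{X\in\mathcal D^{(j)}: [X,\mathcal D^{(j)}]\subseteq\mathcal D^{(j)}\}$. The bundle $\mathcal D$ is totally regular if all $\mathcal D^{(j)}$ and $\mathrm{Char}\,\mathcal D^{(j)}$ have constant rank. A totally regular $\mathcal D$ with $k\geq 1$ and $\mathcal D^{(k)}=TN$ is a \emph{Goursat bundle} of signature $\langle\rho_1,\dots,\rho_k\rangle$, where the $\rho_i$ are non-negative integers, if, with $\Delta_i=\rho_i+\dots+\rho_k$, $m_0=1+\rho_1+\dots+\rho_k$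 and $m_j=m_0+\Delta_1+\dots+\Delta_j$: \begin{enumerate} \item $\mathrm{rank}\,\mathcal D^{(j)}=m_j$ for $0\le j\le k$, $\mathrm{rank}\,\mathrm{Char}\,\mathcal D^{(j)}=2m_j-m_{j+1}-1$ for $0\le j\le k-1$, and $\mathrm{rank}\,\mathrm{Char}\,\mathcal D^{(k)}=m_k$; \item for $1\le i\le k-1$ the intersection bundle $\mathcal D^{(i-1)}\cap\mathrm{Char}\,\mathcal D^{(i)}$ is an integrable sub-bundle of rank $m_{i-1}-1$; \item if $\Delta_k>1$, then $\mathcal D^{(k-1)}$ carries an integrable Weber structure. \end{enumerate} Here a totally regular $\mathcal W$ with $\mathrm{rank}\,\mathcal W=c+q+1$, $\mathrm{rank}\,\mathcal W^{(1)}=c+2q+1$, $\mathrm{rank}\,\mathrm{Char}\,\mathcal W=c$ and $q\ge2$ carries an integrable Weber structure if there is an integrable sub-bundle $R$ of rank $q+c$ with $\mathrm{Char}\,\mathcal W\subseteq R\subseteq\mathcal W$ such that a vector $v\in\mathcal W\setminus\mathrm{Char}\,\mathcal W$ lies in $R$ if and only if $w\mapsto[v,w]\bmod\mathcal W$ has less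 than generic (that is, maximal) rank on the fibre of $\mathcal W$, and this rank is $1$ for every such $v\in R$. \textbf{Proposition.} For every such $H$, the quotient $\mathcal V/H$ is not a Goursat bundle on $M/H$ (of any derived length and signature). -/

import Mathlib

open scoped Manifold ContDiff Topology

noncomputable section

namespace GoursatTheory

section Distributions

variable {E : Type*} [NormedAddCommGroup E] [NormedSpace ℝ E]
  {H : Type*} [TopologicalSpace H] (I : ModelWithCorners ℝ E H)
  {M : Type*} [TopologicalSpace M] [ChartedSpace H M] [IsManifold I ∞ M]

/-- `X` is a smooth local section of the distribution `D`, defined near `x`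
(values of `X` far from `x` are irrelevant). -/
def IsLocalSection (D : ∀ x : M, Submodule ℝ (TangentSpace I x)) (x : M)
    (X : ∀ y : M, TangentSpace I y) : Prop :=
  ∀ᶠ y in 𝓝 x,
    ContMDiffAt I I.tangent ∞ (fun z => (⟨z, X z⟩ : TangentBundle I M)) y ∧ X y ∈ D y

/-- `D` has constant rank `r`. -/
def HasRank (D : ∀ x : M, Submodule ℝ (TangentSpace I x)) (r : ℕ) : Prop :=
  ∀ x : M, Module.finrank ℝ (D x) = r

/-- `D` is a smooth sub-bundle of `TM`: it has constant rank, and every vector of `D` extends to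
a smooth local section. -/
def IsSubbundle (D : ∀ x : M, Submodule ℝ (TangentSpace I x)) : Prop :=
  (∃ r : ℕ, HasRank I D r) ∧
    ∀ (x : M), ∀ v ∈ D x, ∃ X : ∀ y : M, TangentSpace I y, IsLocalSection I D x X ∧ X x = v

/-- The derived distribution `D + [D, D]`. -/
def derivedDist (D : ∀ x : M, Submodule ℝ (TangentSpace I x)) :
    ∀ x : M, Submodule ℝ (TangentSpace I x) :=
  fun x => D x ⊔ Submodule.span ℝ {v | ∃ X Y : ∀ y : M, TangentSpace I y,
    IsLocalSection I D x X ∧ IsLocalSection I D x Y ∧ VectorField.mlieBracket I X Y x = v}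

/-- The derived flag `D⁽⁰⁾ = D`, `D⁽ʲ⁺¹⁾ = D⁽ʲ⁾ + [D⁽ʲ⁾, D⁽ʲ⁾]`. -/
def derivedFlag (D : ∀ x : M, Submodule ℝ (TangentSpace I x)) :
    ℕ → ∀ x : M, Submodule ℝ (TangentSpace I x)
  | 0 => D
  | j + 1 => derivedDist I (derivedFlag D j)

/-- `k` is the derived length of `D`: the smallest integer with `D⁽ᵏ⁾ = D⁽ᵏ⁺¹⁾`. -/
def IsDerivedLength (D : ∀ x : M, Submodule ℝ (TangentSpace I x)) (k : ℕ) : Prop :=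
  IsLeast {j : ℕ | derivedFlag I D j = derivedFlag I D (j + 1)} k

/-- The Cauchy bundle of `D`, spanned by the local sections `X` of `D` with `[X, D] ⊆ D`. -/
def cauchyDist (D : ∀ x : M, Submodule ℝ (TangentSpace I x)) :
    ∀ x : M, Submodule ℝ (TangentSpace I x) :=
  fun x => Submodule.span ℝ {v | ∃ X : ∀ y : M, TangentSpace I y,
    IsLocalSection I D x X ∧
    (∀ᶠ y in 𝓝 x, ∀ Y : ∀ z : M, TangentSpace I z,
      IsLocalSection I D y Y → VectorField.mlieBracket I X Y y ∈ D y) ∧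
    X x = v}

/-- The intersection bundle `D⁽ⁱ⁻¹⁾ ∩ Char D⁽ⁱ⁾` (used for `1 ≤ i`). -/
def intersectionDist (D : ∀ x : M, Submodule ℝ (TangentSpace I x)) (i : ℕ) :
    ∀ x : M, Submodule ℝ (TangentSpace I x) :=
  fun x => derivedFlag I D (i - 1) x ⊓ cauchyDist I (derivedFlag I D i) x

/-- `D` is totally regular: a smooth sub-bundle all of whose derived bundles and their Cauchy
bundles have constant rank. -/
def IsTotallyRegular (D : ∀ x : M, Submodule ℝ (TangentSpace I x)) : Prop :=
  IsSubbundle I D ∧ ∀ j : ℕ, (∃ r : ℕ, HasRank I (derivedFlag I D j) r) ∧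
    ∃ c : ℕ, HasRank I (cauchyDist I (derivedFlag I D j)) c

/-- `D` is an integrable sub-bundle (in the involutive form of Frobenius). -/
def IsIntegrableSubbundle (D : ∀ x : M, Submodule ℝ (TangentSpace I x)) : Prop :=
  IsSubbundle I D ∧ ∀ (x : M) (X Y : ∀ y : M, TangentSpace I y),
    IsLocalSection I D x X → IsLocalSection I D x Y → VectorField.mlieBracket I X Y x ∈ D x

/-- The degree of `v ∈ D x`: the rank of `w ↦ δ(v, w)`, where `δ : Λ²D → TM/D`,
`δ(X, Y) = [X, Y] mod D`, is the structure tensor of `D`. -/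
def polarDegree (D : ∀ x : M, Submodule ℝ (TangentSpace I x)) (x : M)
    (v : TangentSpace I x) : ℕ :=
  Module.finrank ℝ ((Submodule.span ℝ {w | ∃ X Y : ∀ y : M, TangentSpace I y,
    IsLocalSection I D x X ∧ IsLocalSection I D x Y ∧ X x = v ∧
      VectorField.mlieBracket I X Y x = w}).map (D x).mkQ)

/-- `D` carries an integrable Weber structure: `rank D = c + q + 1`, `rank D⁽¹⁾ = c + 2q + 1`,
`rank Char D = c` with `q ≥ 2`, and there is a rank `q + c` sub-bundle `R` (the resolvent bundle)
with `Char D ⊆ R ⊆ D` such that the singular variety of `D / Char D` (the classes of the vectors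
of less than generic, i.e. less than maximal, degree) is the projectivisation of `R / Char D`, all
of whose points have degree one; moreover `R` is integrable. -/
def HasIntegrableWeberStructure (D : ∀ x : M, Submodule ℝ (TangentSpace I x)) : Prop :=
  ∃ q c : ℕ, 2 ≤ q ∧ IsTotallyRegular I D ∧
    HasRank I D (c + q + 1) ∧ HasRank I (derivedDist I D) (c + 2 * q + 1) ∧
    HasRank I (cauchyDist I D) c ∧
    ∃ R : ∀ x : M, Submodule ℝ (TangentSpace I x),
      IsIntegrableSubbundle I R ∧ HasRank I R (q + c) ∧
      (∀ x : M, cauchyDist I D x ≤ R x ∧ R x ≤ D x) ∧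
      ∀ (x : M), ∀ v ∈ D x, v ∉ cauchyDist I D x →
        ((v ∈ R x ↔ ∃ w ∈ D x, polarDegree I D x v < polarDegree I D x w) ∧
          (v ∈ R x → polarDegree I D x v = 1))

end Distributions

/-- The entry `Δ i = ρ i + ⋯ + ρ k` of the velocity of the Brunovský normal form of signature
`⟨ρ 1, …, ρ k⟩`. -/
def brunovskyVelocity (k : ℕ) (ρ : ℕ → ℕ) (i : ℕ) : ℕ := ∑ l ∈ Finset.Icc i k, ρ l

/-- The rank `m j = 1 + (ρ 1 + ⋯ + ρ k) + (Δ 1 + ⋯ + Δ j)` of the `j`-th derived bundle of the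
Brunovský normal form of signature `⟨ρ 1, …, ρ k⟩`. -/
def brunovskyRank (k : ℕ) (ρ : ℕ → ℕ) (j : ℕ) : ℕ :=
  1 + ∑ l ∈ Finset.Icc 1 k, ρ l + ∑ i ∈ Finset.Icc 1 j, brunovskyVelocity k ρ i

section Goursat

variable {E : Type*} [NormedAddCommGroup E] [NormedSpace ℝ E]
  {H : Type*} [TopologicalSpace H] (I : ModelWithCorners ℝ E H)
  {M : Type*} [TopologicalSpace M] [ChartedSpace H M] [IsManifold I ∞ M]

/-- `D` is a Goursat bundle of derived length `k` and signature `⟨ρ 1, …, ρ k⟩`.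
The type numbers are those of the Brunovský normal form of that signature:
`m j = brunovskyRank k ρ j` (which says in particular that the signature is the deceleration
of `D`, that is `ρ k = Δ k` and `ρ j = Δ j - Δ (j + 1)` for `j < k`),
`χ j = 2 m j - m (j + 1) - 1` for `j < k`, and `m (i - 1) - 1` for the rank of the `i`-th
intersection bundle, `1 ≤ i ≤ k - 1`. The case `Δ k > 1` also requires an integrable Weber
structure on `D⁽ᵏ⁻¹⁾`. -/
structure IsGoursatBundleOfSignature (D : ∀ x : M, Submodule ℝ (TangentSpace I x))
    (k : ℕ) (ρ : ℕ → ℕ) : Prop where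
  one_le : 1 ≤ k
  totallyRegular : IsTotallyRegular I D
  derivedLength : IsDerivedLength I D k
  bracketGenerating : ∀ x : M, derivedFlag I D k x = ⊤
  rank_flag : ∀ j ≤ k, HasRank I (derivedFlag I D j) (brunovskyRank k ρ j)
  rank_cauchy : ∀ j < k, ∀ x : M,
    (Module.finrank ℝ (cauchyDist I (derivedFlag I D j) x) : ℤ) =
      2 * brunovskyRank k ρ j - brunovskyRank k ρ (j + 1) - 1
  rank_cauchy_top : HasRank I (cauchyDist I (derivedFlag I D k)) (brunovskyRank k ρ k)
  rank_intersection : ∀ i, 1 ≤ i → i ≤ k - 1 → ∀ x : M,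
    (Module.finrank ℝ (intersectionDist I D i x) : ℤ) = brunovskyRank k ρ (i - 1) - 1
  integrable_intersection : ∀ i, 1 ≤ i → i ≤ k - 1 →
    IsIntegrableSubbundle I (intersectionDist I D i)
  resolvent : 1 < ρ k → HasIntegrableWeberStructure I (derivedFlag I D (k - 1))

/-- `D` is a Goursat bundle (of some signature). -/
def IsGoursatBundle (D : ∀ x : M, Submodule ℝ (TangentSpace I x)) : Prop :=
  ∃ (k : ℕ) (ρ : ℕ → ℕ), IsGoursatBundleOfSignature I D k ρ

end Goursat

/-- The space `ℝ × ℝⁿ × ℝᵐ` of times, states and controls `(t, x, u)`. -/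
abbrev TXU (n m : ℕ) : Type := ℝ × EuclideanSpace ℝ (Fin n) × EuclideanSpace ℝ (Fin m)

/-- The distribution `span {∂ₜ + ∑ fⁱ ∂_{xⁱ}, ∂_{u¹}, …, ∂_{uᵐ}}` of the control system
`ẋ = f(t, x, u)`. -/
def controlDist {n m : ℕ} (f : TXU n m → EuclideanSpace ℝ (Fin n)) :
    ∀ p : TXU n m, Submodule ℝ (TangentSpace 𝓘(ℝ, TXU n m) p) :=
  fun p => (Submodule.span ℝ
    (insert ((1, f p, 0) : TXU n m)
      (Set.range fun a : Fin m => ((0, 0, EuclideanSpace.single a 1) : TXU n m))) :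
    Submodule ℝ (TXU n m))

/-- The infinitesimal generator of a flow. -/
def flowGenerator {n m : ℕ} (φ : ℝ → TXU n m → TXU n m) (p : TXU n m) : TXU n m :=
  deriv (fun s => φ s p) 0

/-- The fibre at `p` of the bundle `Γ` spanned by the infinitesimal generator of a flow. -/
def generatorDist {n m : ℕ} (φ : ℝ → TXU n m → TXU n m) (p : TXU n m) :
    Submodule ℝ (TXU n m) :=
  Submodule.span ℝ {flowGenerator φ p}

/-- The projection `(t, x, u) ↦ (t, x)`. -/
def stateProj (n m : ℕ) : TXU n m →ₗ[ℝ] ℝ × EuclideanSpace ℝ (Fin n) :=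
  LinearMap.prod (LinearMap.fst ℝ _ _) (LinearMap.fst ℝ _ _ ∘ₗ LinearMap.snd ℝ _ _)

/-- A one-parameter transformation group `φ` of the open set `M`, acting smoothly and control
admissibly on the control system `ẋ = f(t, x, u)`. (Regularity of the action, i.e. smoothness of
the orbit space, is expressed by `IsOrbitSpace` below.) -/
structure IsControlAdmissible {n m : ℕ} (f : TXU n m → EuclideanSpace ℝ (Fin n))
    (M : Set (TXU n m)) (φ : ℝ → TXU n m → TXU n m) : Prop where
  mapsTo : ∀ s, Set.MapsTo (φ s) M M
  zero : ∀ p ∈ M, φ 0 p = p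
  add : ∀ s r, ∀ p ∈ M, φ (s + r) p = φ s (φ r p)
  smooth : ContDiffOn ℝ ∞ (fun y : ℝ × TXU n m => φ y.1 y.2) (Set.univ ×ˢ M)
  symmetry : ∀ s, ∀ p ∈ M,
    Submodule.map (fderiv ℝ (φ s) p : TXU n m →ₗ[ℝ] TXU n m) (controlDist f p) =
      controlDist f (φ s p)
  time_invariant : ∀ s, ∀ p ∈ M, (φ s p).1 = p.1
  rank_proj : ∀ p ∈ M, Module.finrank ℝ ((generatorDist φ p).map (stateProj n m)) = 1
  dim_lt : 1 < n
  stronglyTransverse : ∀ p ∈ M,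
    generatorDist φ p ⊓ derivedFlag 𝓘(ℝ, TXU n m) (controlDist f) 1 p = ⊥

section Quotient

variable {n m d : ℕ} {N : Type*} [TopologicalSpace N] [ChartedSpace (EuclideanSpace ℝ (Fin d)) N]

/-- The smooth manifold `N`, with the projection `π : M → N`, is the orbit space of the
transformation group `φ` of `M`: `π` is a smooth surjective submersion on `M` whose fibres are
the orbits. This determines `N` up to a unique diffeomorphism compatible with the projections. -/
structure IsOrbitSpace (M : Set (TXU n m)) (φ : ℝ → TXU n m → TXU n m) (π : TXU n m → N) :
    Prop where
  smooth : ContMDiffOn 𝓘(ℝ, TXU n m) (𝓡 d) ∞ π M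
  surjOn : Set.SurjOn π M Set.univ
  submersion : ∀ p ∈ M, Function.Surjective (mfderiv 𝓘(ℝ, TXU n m) (𝓡 d) π p)
  fibres : ∀ p ∈ M, ∀ q ∈ M, π p = π q ↔ ∃ s : ℝ, φ s p = q

/-- The quotient distribution `dπ(V)` on the orbit space, for a distribution `V` on `M`. -/
def quotientDist (V : ∀ p : TXU n m, Submodule ℝ (TangentSpace 𝓘(ℝ, TXU n m) p))
    (M : Set (TXU n m)) (π : TXU n m → N) : ∀ q : N, Submodule ℝ (TangentSpace (𝓡 d) q) :=
  fun q => Submodule.span ℝ {w | ∃ v : TangentBundle 𝓘(ℝ, TXU n m) (TXU n m),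
    v.1 ∈ M ∧ v.2 ∈ V v.1 ∧ tangentMap 𝓘(ℝ, TXU n m) (𝓡 d) π v = ⟨q, w⟩}

end Quotient

/-- The right-hand side of the PVTOL control system
`ẍ = -u₁ sin θ + h u₂ cos θ`, `z̈ = u₁ cos θ + h u₂ sin θ - g`, `θ̈ = lam u₂`,
with state `(x, ẋ, z, ż, θ, θ̇)` and controls `(u₁, u₂)`. -/
def pvtol (h g lam : ℝ) (p : TXU 6 2) : EuclideanSpace ℝ (Fin 6) :=
  let x := p.2.1
  let u := p.2.2
  !₂[x 1,
    -u 0 * Real.sin (x 4) + h * u 1 * Real.cos (x 4),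
    x 3,
    u 0 * Real.cos (x 4) + h * u 1 * Real.sin (x 4) - g,
    x 5,
    lam * u 1]

end GoursatTheory

end

open GoursatTheory

noncomputable section

namespace GoursatTheory

/-! ### Brackets under smooth maps between normed spaces. -/

section VectorSpace

variable {A E ι : Type*} [NormedAddCommGroup A] [NormedSpace ℝ A]
  [NormedAddCommGroup E] [NormedSpace ℝ E] [Fintype ι]

/-! Let `D` be the quotient distribution and suppose it is Goursat. The obstruction sits in the
Cauchy bundle of `D⁽²⁾`, whose rank the Goursat conditions force to be too large.

Upstairs, bracketing `T`, `∂_{u₁}`, `∂_{u₂}` gives `B₁, B₂` in the first derived bundle, `C₁, C₂` in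
the second and `E, A` in the third, and together these fields span the tangent space. Their images
therefore lie in `D⁽¹⁾, D⁽²⁾, D⁽³⁾`, so that `D⁽³⁾` is the whole tangent bundle, of rank 8. Since
`m₀ ≤ 3` and the `Δᵢ` are non-increasing, this leaves only `Δ = (2, 2, 1)`. Hence `m₂ = 7`, and
`Char D⁽²⁾` has rank `2·7 − 8 − 1 = 5`, which is corank two in `D⁽²⁾`.

A linear form `μ` vanishing on `D⁽²⁾` turns the bracket into a 2-form on `D⁽²⁾` that descends to the
two-dimensional quotient by `Char D⁽²⁾`. Such a form is decomposable, so its values on any four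
sections satisfy the Plücker relation (`structure_plucker`). On `B₁, C₂, B₂, C₁` the relation reads
`−λ² μ(E)² = 0`, which puts `E` in `D⁽²⁾`. On `T, E, C₂, C₁` it then reads `−λ μ(A)² = 0`, which
puts `A` in `D⁽²⁾`. Now `D⁽²⁾` is everything, of rank 8 and not 7.

The fields above need not be invariant under the group, so they need not descend to the orbit space,
where the derived flag lives. The bridge is `mfderiv_lieBracket_of_eq_sum`: along `π` the image of
each field is expanded in a local frame downstairs, with coefficients that are functions upstairs,
and the bracket is computed from these expansions. The chart and frame lemmas serve to make this
legitimate. -/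

theorem fderiv_fderiv_apply_add_of_eq_sum {G : A → E} {p : A} (hG : ContDiffAt ℝ 2 G p)
    {X : A → A} (hX : DifferentiableAt ℝ X p) {f : ι → A → ℝ} {Y : ι → E → E}
    (hf : ∀ i, DifferentiableAt ℝ (f i) p) (hY : ∀ i, DifferentiableAt ℝ (Y i) (G p))
    (h : ∀ᶠ x in 𝓝 p, fderiv ℝ G x (X x) = ∑ i, f i x • Y i (G x)) (v : A) :
    fderiv ℝ (fderiv ℝ G) p v (X p) + fderiv ℝ G p (fderiv ℝ X p v) =
      ∑ i, (fderiv ℝ (f i) p v • Y i (G p) +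
        f i p • fderiv ℝ (Y i) (G p) (fderiv ℝ G p v)) := by
  have hG1 : DifferentiableAt ℝ G p := hG.differentiableAt (by norm_num)
  have hG2 : DifferentiableAt ℝ (fderiv ℝ G) p :=
    (hG.fderiv_right (m := 1) (by norm_num)).differentiableAt (by norm_num)
  have h1 := hG2.hasFDerivAt.clm_apply hX.hasFDerivAt
  have h2 : HasFDerivAt (fun x => ∑ i, f i x • Y i (G x)) _ p :=
    HasFDerivAt.fun_sum fun i _ =>
      (hf i).hasFDerivAt.smul ((hY i).hasFDerivAt.comp p hG1.hasFDerivAt)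
  -- The product rule applied to each side of `h` gives two derivatives of the same map; they agree
  -- by uniqueness.
  have h3 := (h1.congr_of_eventuallyEq (h.mono fun x hx => hx.symm)).unique h2
  have h4 := congrArg (fun L : A →L[ℝ] E => L v) h3
  simp only [add_apply, ContinuousLinearMap.coe_comp, Function.comp_apply,
    ContinuousLinearMap.flip_apply, sum_apply, smul_apply,
    ContinuousLinearMap.smulRight_apply] at h4
  rw [add_comm, h4]
  exact Finset.sum_congr rfl fun i _ => add_comm _ _

/-- The bracket of two vector fields whose images under a smooth map `G` are combinations of
vector fields on the target. -/
theorem fderiv_lieBracket_of_eq_sum {G : A → E} {p : A} (hG : ContDiffAt ℝ 2 G p)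
    {X X' : A → A} (hX : DifferentiableAt ℝ X p) (hX' : DifferentiableAt ℝ X' p)
    {f g : ι → A → ℝ} {Y : ι → E → E}
    (hf : ∀ i, DifferentiableAt ℝ (f i) p) (hg : ∀ i, DifferentiableAt ℝ (g i) p)
    (hY : ∀ i, DifferentiableAt ℝ (Y i) (G p))
    (h : ∀ᶠ x in 𝓝 p, fderiv ℝ G x (X x) = ∑ i, f i x • Y i (G x))
    (h' : ∀ᶠ x in 𝓝 p, fderiv ℝ G x (X' x) = ∑ i, g i x • Y i (G x)) :
    fderiv ℝ G p (VectorField.lieBracket ℝ X X' p) =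
      ∑ i, (fderiv ℝ (g i) p (X p) - fderiv ℝ (f i) p (X' p)) • Y i (G p) +
        ∑ i, ∑ j, (f i p * g j p) • VectorField.lieBracket ℝ (Y i) (Y j) (G p) := by
  have e1 := fderiv_fderiv_apply_add_of_eq_sum hG hX' hg hY h' (X p)
  have e2 := fderiv_fderiv_apply_add_of_eq_sum hG hX hf hY h (X' p)
  -- Symmetry of the second derivative makes the second-order terms cancel in the bracket.
  have hs : fderiv ℝ (fderiv ℝ G) p (X p) (X' p) = fderiv ℝ (fderiv ℝ G) p (X' p) (X p) :=
    (hG.isSymmSndFDerivAt (by simp)).eq _ _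
  have e3 : fderiv ℝ G p (VectorField.lieBracket ℝ X X' p) =
      ∑ i, (fderiv ℝ (g i) p (X p) • Y i (G p) +
        g i p • fderiv ℝ (Y i) (G p) (fderiv ℝ G p (X p))) -
      ∑ i, (fderiv ℝ (f i) p (X' p) • Y i (G p) +
        f i p • fderiv ℝ (Y i) (G p) (fderiv ℝ G p (X' p))) := by
    rw [← e1, ← e2, hs, VectorField.lieBracket_eq, map_sub]
    abel
  have e4 : ∑ i, ∑ j, (f i p * g j p) • VectorField.lieBracket ℝ (Y i) (Y j) (G p) =
      ∑ j, g j p • fderiv ℝ (Y j) (G p) (fderiv ℝ G p (X p)) -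
      ∑ i, f i p • fderiv ℝ (Y i) (G p) (fderiv ℝ G p (X' p)) := by
    rw [h.self_of_nhds, h'.self_of_nhds]
    simp only [VectorField.lieBracket_eq, map_sum, map_smul, Finset.smul_sum, smul_sub,
      Finset.sum_sub_distrib, smul_smul]
    congr 1
    rw [Finset.sum_comm]
    simp only [mul_comm]
  rw [e3, e4]
  simp only [sub_smul, Finset.sum_add_distrib, Finset.sum_sub_distrib]
  abel

/-- A differentiable map with values in the span of a differentiable frame has differentiable
coefficients. -/
theorem exists_differentiableAt_coeff [FiniteDimensional ℝ E] {p : A} {y : ι → A → E} {v : A → E}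
    (hy : ∀ i, DifferentiableAt ℝ (y i) p) (hv : DifferentiableAt ℝ v p)
    (hli : LinearIndependent ℝ fun i => y i p)
    (h : ∀ᶠ x in 𝓝 p, v x ∈ Submodule.span ℝ (Set.range fun i => y i x)) :
    ∃ f : ι → A → ℝ, (∀ i, DifferentiableAt ℝ (f i) p) ∧
      ∀ᶠ x in 𝓝 p, v x = ∑ i, f i x • y i x := by
  classical
  obtain ⟨L, hL⟩ := (Fintype.linearCombination ℝ fun i => y i p).exists_leftInverse_of_injective
    (LinearMap.ker_eq_bot.2 (linearIndependent_iff_injective_fintypeLinearCombination.1 hli))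
  let L' : E →L[ℝ] (ι → ℝ) := LinearMap.toContinuousLinearMap L
  -- `B x` sends coefficients to their combination of the `y i x` and back by `L`. It is the
  -- identity at `p`, hence invertible nearby, and `B⁻¹ L v` gives the coefficients of `v`,
  -- differentiably in `x`.
  let B : A → (ι → ℝ) →L[ℝ] (ι → ℝ) := fun x =>
    ∑ j, (ContinuousLinearMap.proj (R := ℝ) (φ := fun _ : ι => ℝ) j).smulRight (L' (y j x))
  have hB : ∀ x c, B x c = L' (∑ j, c j • y j x) := fun x c => by simp [B]
  have hBp : B p = 1 := by
    ext1 c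
    rw [hB]
    exact LinearMap.congr_fun hL c
  have hBd : DifferentiableAt ℝ B p := by
    refine DifferentiableAt.fun_sum fun j _ => ?_
    exact ((ContinuousLinearMap.smulRightL ℝ (ι → ℝ) (ι → ℝ)
      (ContinuousLinearMap.proj j)).comp L').differentiableAt.comp p (hy j)
  have hinv : DifferentiableAt ℝ (fun x => Ring.inverse (B x)) p := by
    have := differentiableAt_inverse (𝕜 := ℝ) (x := B p) (by rw [hBp]; exact isUnit_one)
    exact this.comp p hBd
  have hunit : ∀ᶠ x in 𝓝 p, IsUnit (B x) := by
    refine hBd.continuousAt.eventually (Units.isOpen.mem_nhds ?_)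
    rw [hBp]
    exact isUnit_one
  have hc : DifferentiableAt ℝ (fun x => Ring.inverse (B x) (L' (v x))) p :=
    hinv.clm_apply (L'.differentiableAt.comp p hv)
  refine ⟨fun i x => Ring.inverse (B x) (L' (v x)) i, fun i => differentiableAt_pi.1 hc i, ?_⟩
  filter_upwards [h, hunit] with x hx hu
  obtain ⟨c, hc⟩ := (Submodule.mem_span_range_iff_exists_fun ℝ).1 hx
  have : Ring.inverse (B x) (L' (v x)) = c := by
    rw [← hc, ← hB, ← mul_apply_eq_comp, Ring.inverse_mul_cancel _ hu]
    rfl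
  simp only [this, hc]

end VectorSpace

/-! ### Vector fields and their brackets read in a chart. -/

section Coordinates

variable {E : Type*} [NormedAddCommGroup E] [NormedSpace ℝ E]
  {H : Type*} [TopologicalSpace H] {I : ModelWithCorners ℝ E H}
  {N : Type*} [TopologicalSpace N] [ChartedSpace H N] [IsManifold I ∞ N]

variable (I) in
/-- A vector field in the preferred chart at `q`. -/
def chartField (q : N) (Y : ∀ y : N, TangentSpace I y) : E → E :=
  VectorField.mpullbackWithin 𝓘(ℝ, E) I (extChartAt I q).symm Y (Set.range I)

theorem eventually_mfderiv_extChartAt_apply (q : N) (Y : ∀ y : N, TangentSpace I y) :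
    ∀ᶠ y in 𝓝 q, mfderiv I 𝓘(ℝ, E) (extChartAt I q) y (Y y) =
      chartField I q Y (extChartAt I q y) := by
  have : IsManifold I 1 N := IsManifold.of_le (n := ∞) (by norm_cast)
  have h := VectorField.eventuallyEq_mpullback_mpullbackWithin_extChartAt (I := I) (x := q)
    (s := Set.univ) Y
  rw [nhdsWithin_univ] at h
  filter_upwards [h, extChartAt_source_mem_nhds (I := I) q] with y hy hys
  rw [VectorField.mpullback_apply] at hy
  exact (((isInvertible_mfderiv_extChartAt hys).inverse_apply_eq).1 hy.symm).symm

theorem differentiableAt_chartField [FiniteDimensional ℝ E] [I.Boundaryless] {q : N}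
    {Y : ∀ y : N, TangentSpace I y}
    (hY : ContMDiffAt I I.tangent ∞ (fun z => (⟨z, Y z⟩ : TangentBundle I N)) q) :
    DifferentiableAt ℝ (chartField I q Y) (extChartAt I q q) := by
  have : CompleteSpace E := FiniteDimensional.complete ℝ E
  have : IsManifold I 2 N := IsManifold.of_le (n := ∞) (by norm_cast)
  have h := (hY.mdifferentiableAt (by simp)).mdifferentiableWithinAt
    (s := Set.univ) |>.differentiableWithinAt_mpullbackWithin_vectorField
  rw [Set.preimage_univ, Set.univ_inter, I.range_eq_univ] at h
  have h' : DifferentiableWithinAt ℝ (chartField I q Y) Set.univ (extChartAt I q q) := by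
    rwa [chartField, I.range_eq_univ]
  rwa [differentiableWithinAt_univ] at h'

/-- The manifold bracket is defined by pulling back to the chart. Without boundary the range of `I`
is everything, so the bracket within a set becomes the ordinary one. -/
theorem mfderiv_extChartAt_mlieBracket [I.Boundaryless] (q : N) (Y Z : ∀ y : N, TangentSpace I y) :
    mfderiv I 𝓘(ℝ, E) (extChartAt I q) q (VectorField.mlieBracket I Y Z q) =
      VectorField.lieBracket ℝ (chartField I q Y) (chartField I q Z) (extChartAt I q q) := by
  have : IsManifold I 1 N := IsManifold.of_le (n := ∞) (by norm_cast)
  have e : VectorField.lieBracketWithin ℝ (chartField I q Y) (chartField I q Z)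
      ((extChartAt I q).symm ⁻¹' Set.univ ∩ Set.range I) (extChartAt I q q) =
      VectorField.lieBracket ℝ (chartField I q Y) (chartField I q Z) (extChartAt I q q) := by
    rw [Set.preimage_univ, Set.univ_inter, I.range_eq_univ, VectorField.lieBracketWithin_univ]
  have h := VectorField.mlieBracketWithin_apply (I := I) (V := Y) (W := Z) (s := Set.univ)
    (x₀ := q)
  exact ((isInvertible_mfderiv_extChartAt (mem_extChartAt_source q)).inverse_apply_eq.1
    h.symm).symm.trans e

end Coordinates

/-! ### Brackets of fields that need not descend along a smooth map. -/

section Lift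

variable {A : Type*} [NormedAddCommGroup A] [NormedSpace ℝ A]
  {E : Type*} [NormedAddCommGroup E] [NormedSpace ℝ E]
  {H : Type*} [TopologicalSpace H] {I : ModelWithCorners ℝ E H}
  {N : Type*} [TopologicalSpace N] [ChartedSpace H N] [IsManifold I ∞ N]
  {ι : Type*} [Fintype ι]

omit [IsManifold I ∞ N] in
theorem contDiffAt_extChartAt_comp {π : A → N} {p : A} (hπ : ContMDiffAt 𝓘(ℝ, A) I ∞ π p) :
    ContDiffAt ℝ ∞ (extChartAt I (π p) ∘ π) p :=
  (contMDiffAt_extChartAt.comp p hπ).contDiffAt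

theorem eventually_fderiv_extChartAt_comp {π : A → N} {p : A}
    (hπ : ContMDiffAt 𝓘(ℝ, A) I ∞ π p) :
    ∀ᶠ x in 𝓝 p, ∀ v : A, fderiv ℝ (extChartAt I (π p) ∘ π) x v =
      mfderiv I 𝓘(ℝ, E) (extChartAt I (π p)) (π x) (mfderiv 𝓘(ℝ, A) I π x v) := by
  have : IsManifold I 1 N := IsManifold.of_le (n := ∞) (by norm_cast)
  have h1 : ∀ᶠ x in 𝓝 p, MDifferentiableAt 𝓘(ℝ, A) I π x := by
    have h : ContMDiffAt 𝓘(ℝ, A) I 1 π p := hπ.of_le (by norm_cast)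
    filter_upwards [(contMDiffAt_iff_contMDiffAt_nhds (by simp)).1 h] with x hx
    exact hx.mdifferentiableAt (by simp)
  have h2 : ∀ᶠ x in 𝓝 p, π x ∈ (chartAt H (π p)).source :=
    hπ.continuousAt.eventually (chart_source_mem_nhds H (π p))
  filter_upwards [h1, h2] with x hx hs v
  rw [← mfderiv_eq_fderiv, mfderiv_comp x (mdifferentiableAt_extChartAt hs) hx]
  rfl

theorem eventually_fderiv_eq_sum {π : A → N} {p : A} (hπ : ContMDiffAt 𝓘(ℝ, A) I ∞ π p)
    {X : A → A} {f : ι → A → ℝ} {Y : ι → ∀ y : N, TangentSpace I y}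
    (h : ∀ᶠ x in 𝓝 p, mfderiv 𝓘(ℝ, A) I π x (X x) = ∑ i, f i x • Y i (π x)) :
    ∀ᶠ x in 𝓝 p, fderiv ℝ (extChartAt I (π p) ∘ π) x (X x) =
      ∑ i, f i x • chartField I (π p) (Y i) ((extChartAt I (π p) ∘ π) x) := by
  have h1 : ∀ᶠ x in 𝓝 p, ∀ i, mfderiv I 𝓘(ℝ, E) (extChartAt I (π p)) (π x) (Y i (π x)) =
      chartField I (π p) (Y i) (extChartAt I (π p) (π x)) :=
    Filter.eventually_all.2 fun i =>
      hπ.continuousAt.eventually (eventually_mfderiv_extChartAt_apply (π p) (Y i))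
  filter_upwards [h, h1, eventually_fderiv_extChartAt_comp hπ] with x hx h1x h2x
  rw [h2x, hx, map_sum]
  refine Finset.sum_congr rfl fun i _ => ?_
  rw [map_smul, h1x]
  rfl

variable [FiniteDimensional ℝ E] [I.Boundaryless]

theorem differentiableAt_chartField_comp {π : A → N} {p : A}
    (hπ : ContMDiffAt 𝓘(ℝ, A) I ∞ π p) {Y : ∀ y : N, TangentSpace I y}
    (hY : ContMDiffAt I I.tangent ∞ (fun z => (⟨z, Y z⟩ : TangentBundle I N)) (π p)) :
    DifferentiableAt ℝ
      (fun x => chartField I (π p) Y ((extChartAt I (π p) ∘ π) x)) p :=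
  (differentiableAt_chartField hY).comp p
    ((contDiffAt_extChartAt_comp hπ).differentiableAt (by simp))

/-- The image under `dπ` of the bracket of two vector fields whose images are combinations of
vector fields on the target. -/
theorem mfderiv_lieBracket_of_eq_sum {π : A → N} {p : A} (hπ : ContMDiffAt 𝓘(ℝ, A) I ∞ π p)
    {X X' : A → A} (hX : DifferentiableAt ℝ X p) (hX' : DifferentiableAt ℝ X' p)
    {f g : ι → A → ℝ} {Y : ι → ∀ y : N, TangentSpace I y}
    (hf : ∀ i, DifferentiableAt ℝ (f i) p) (hg : ∀ i, DifferentiableAt ℝ (g i) p)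
    (hY : ∀ i,
      ContMDiffAt I I.tangent ∞ (fun z => (⟨z, Y i z⟩ : TangentBundle I N)) (π p))
    (h : ∀ᶠ x in 𝓝 p, mfderiv 𝓘(ℝ, A) I π x (X x) = ∑ i, f i x • Y i (π x))
    (h' : ∀ᶠ x in 𝓝 p, mfderiv 𝓘(ℝ, A) I π x (X' x) = ∑ i, g i x • Y i (π x)) :
    mfderiv 𝓘(ℝ, A) I π p (VectorField.lieBracket (E := A) ℝ X X' p) =
      ∑ i, (fderiv ℝ (g i) p (X p) - fderiv ℝ (f i) p (X' p)) • Y i (π p) +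
        ∑ i, ∑ j, (f i p * g j p) • VectorField.mlieBracket I (Y i) (Y j) (π p) := by
  have : IsManifold I 1 N := IsManifold.of_le (n := ∞) (by norm_cast)
  have key := fderiv_lieBracket_of_eq_sum
    ((contDiffAt_extChartAt_comp hπ).of_le (by norm_cast)) hX hX' hf hg
    (fun i => differentiableAt_chartField (hY i))
    (eventually_fderiv_eq_sum hπ h) (eventually_fderiv_eq_sum hπ h')
  apply (isInvertible_mfderiv_extChartAt (mem_extChartAt_source (I := I) (π p))).injective
  rw [← (eventually_fderiv_extChartAt_comp hπ).self_of_nhds]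
  refine key.trans ?_
  simp only [map_add, map_sum, map_smul, mfderiv_extChartAt_mlieBracket,
    (eventually_mfderiv_extChartAt_apply (π p) (Y _)).self_of_nhds]
  rfl

/-- The coefficients, in a local frame of `D`, of a vector field which `dπ` maps into `D`. -/
theorem exists_differentiableAt_frame_coeff {π : A → N} {p : A}
    (hπ : ContMDiffAt 𝓘(ℝ, A) I ∞ π p) {D : ∀ y : N, Submodule ℝ (TangentSpace I y)}
    (hD : HasRank I D (Fintype.card ι)) {Y : ι → ∀ y : N, TangentSpace I y}
    (hY : ∀ i, IsLocalSection I D (π p) (Y i)) (hli : LinearIndependent ℝ fun i => Y i (π p))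
    {X : A → A} (hX : DifferentiableAt ℝ X p)
    (h : ∀ᶠ x in 𝓝 p, mfderiv 𝓘(ℝ, A) I π x (X x) ∈ D (π x)) :
    ∃ f : ι → A → ℝ, (∀ i, DifferentiableAt ℝ (f i) p) ∧
      ∀ᶠ x in 𝓝 p, mfderiv 𝓘(ℝ, A) I π x (X x) = ∑ i, f i x • Y i (π x) := by
  have : IsManifold I 1 N := IsManifold.of_le (n := ∞) (by norm_cast)
  set G := extChartAt I (π p) ∘ π with hG
  have hGs : ContDiffAt ℝ ∞ G p := contDiffAt_extChartAt_comp hπ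
  have hYc : ∀ᶠ x in 𝓝 p, ∀ i, mfderiv I 𝓘(ℝ, E) (extChartAt I (π p)) (π x) (Y i (π x)) =
      chartField I (π p) (Y i) (G x) :=
    Filter.eventually_all.2 fun i =>
      hπ.continuousAt.eventually (eventually_mfderiv_extChartAt_apply (π p) (Y i))
  have hYD : ∀ᶠ x in 𝓝 p, ∀ i, Y i (π x) ∈ D (π x) :=
    Filter.eventually_all.2 fun i =>
      hπ.continuousAt.eventually ((hY i).mono fun y hy => hy.2)
  have hinj : ∀ᶠ x in 𝓝 p,
      Function.Injective (mfderiv I 𝓘(ℝ, E) (extChartAt I (π p)) (π x)) := by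
    filter_upwards [hπ.continuousAt.eventually (extChartAt_source_mem_nhds (I := I) (π p))]
      with x hx
    exact (isInvertible_mfderiv_extChartAt hx).injective
  have hyd : ∀ i, DifferentiableAt ℝ (fun x => chartField I (π p) (Y i) (G x)) p := fun i =>
    differentiableAt_chartField_comp hπ (hY i).self_of_nhds.1
  have hlip : LinearIndependent ℝ fun i => chartField I (π p) (Y i) (G p) := by
    have := hli.map' (mfderiv I 𝓘(ℝ, E) (extChartAt I (π p)) (π p)).toLinearMap
      (LinearMap.ker_eq_bot.2 hinj.self_of_nhds)
    convert! this using 1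
    funext i
    exact (hYc.self_of_nhds i).symm
  -- Independence is an open condition; with the constant rank of `D` it makes the `Y i` a basis of
  -- `D` at all nearby points.
  have hlix : ∀ᶠ x in 𝓝 p, LinearIndependent ℝ fun i => chartField I (π p) (Y i) (G x) :=
    (continuousAt_pi.2 fun i => (hyd i).continuousAt).eventually hlip.eventually
  have hsum : ∀ᶠ x in 𝓝 p, ∃ c : ι → ℝ,
      mfderiv 𝓘(ℝ, A) I π x (X x) = ∑ i, c i • Y i (π x) := by
    filter_upwards [h, hYc, hYD, hlix] with x hx hYcx hYDx hlx
    have hl : LinearIndependent ℝ fun i => Y i (π x) := by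
      refine LinearIndependent.of_comp
        (mfderiv I 𝓘(ℝ, E) (extChartAt I (π p)) (π x)).toLinearMap ?_
      convert! hlx using 1
      funext i
      exact hYcx i
    have hspan : Submodule.span ℝ (Set.range fun i => Y i (π x)) = D (π x) := by
      have : FiniteDimensional ℝ (TangentSpace I (π x)) := inferInstanceAs (FiniteDimensional ℝ E)
      refine Submodule.eq_of_le_of_finrank_eq
        (Submodule.span_le.2 (Set.range_subset_iff.2 hYDx)) ?_
      rw [finrank_span_eq_card hl, hD]
    rw [← hspan] at hx
    obtain ⟨c, hc⟩ := (Submodule.mem_span_range_iff_exists_fun ℝ).1 hx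
    exact ⟨c, hc.symm⟩
  have hGX := eventually_fderiv_extChartAt_comp hπ
  have hdX : DifferentiableAt ℝ (fun x => fderiv ℝ G x (X x)) p :=
    ((hGs.fderiv_right (m := 1) (by norm_cast)).differentiableAt (by norm_num)).clm_apply hX
  -- The coefficients are found in the chart, and carried back to the manifold because the chart has
  -- injective derivative.
  obtain ⟨f, hf, hfs⟩ := exists_differentiableAt_coeff hyd hdX hlip (by
    filter_upwards [hsum, hYc, hGX] with x hx hYcx hGx
    obtain ⟨c, hc⟩ := hx
    refine (Submodule.mem_span_range_iff_exists_fun ℝ).2 ⟨c, ?_⟩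
    rw [hGx, hc, map_sum]
    refine Finset.sum_congr rfl fun i _ => ?_
    rw [map_smul, hYcx]
    rfl)
  refine ⟨f, hf, ?_⟩
  filter_upwards [hfs, hinj, hYc, hGX] with x hx hix hYcx hGx
  apply hix
  rw [← hGx, map_sum]
  refine hx.trans (Finset.sum_congr rfl fun i _ => ?_)
  rw [map_smul, hYcx]
  rfl

end Lift

/-! ### Derived flags, Cauchy bundles and the Plücker relation. -/

section DerivedFlag

variable {E : Type*} [NormedAddCommGroup E] [NormedSpace ℝ E]
  {H : Type*} [TopologicalSpace H] {I : ModelWithCorners ℝ E H}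
  {N : Type*} [TopologicalSpace N] [ChartedSpace H N] [IsManifold I ∞ N]

variable (I) in
/-- Every vector of `D` extends to a smooth local section. -/
def HasLocalSections (D : ∀ x : N, Submodule ℝ (TangentSpace I x)) : Prop :=
  ∀ (x : N), ∀ v ∈ D x, ∃ X : ∀ y : N, TangentSpace I y, IsLocalSection I D x X ∧ X x = v

theorem IsLocalSection.mono {D D' : ∀ x : N, Submodule ℝ (TangentSpace I x)}
    (h : ∀ x, D x ≤ D' x) {x : N} {X : ∀ y : N, TangentSpace I y}
    (hX : IsLocalSection I D x X) : IsLocalSection I D' x X :=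
  Filter.Eventually.mono hX fun y hy => ⟨hy.1, h y hy.2⟩

theorem le_derivedDist (D : ∀ x : N, Submodule ℝ (TangentSpace I x)) (x : N) :
    D x ≤ derivedDist I D x :=
  le_sup_left

theorem IsLocalSection.mlieBracket_mem_derivedDist
    {D : ∀ x : N, Submodule ℝ (TangentSpace I x)} {x : N} {X Y : ∀ y : N, TangentSpace I y}
    (hX : IsLocalSection I D x X) (hY : IsLocalSection I D x Y) :
    VectorField.mlieBracket I X Y x ∈ derivedDist I D x :=
  (le_sup_right : _ ≤ derivedDist I D x) (Submodule.subset_span ⟨X, Y, hX, hY, rfl⟩)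

/-- A local section near `x` is also one near each nearby `y`, so the pointwise membership of the
bracket holds on a neighbourhood; smoothness of order `∞` survives the loss of one derivative. -/
theorem IsLocalSection.mlieBracket [CompleteSpace E]
    {D : ∀ x : N, Submodule ℝ (TangentSpace I x)} {x : N} {X Y : ∀ y : N, TangentSpace I y}
    (hX : IsLocalSection I D x X) (hY : IsLocalSection I D x Y) :
    IsLocalSection I (derivedDist I D) x (VectorField.mlieBracket I X Y) := by
  have : IsManifold I ((⊤ : ℕ∞) + 1) N := ‹IsManifold I ∞ N›
  have : IsManifold I (minSmoothness ℝ 3) N := IsManifold.of_le (n := ∞) (by simp; norm_cast)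
  filter_upwards [eventually_eventually_nhds.2 hX, eventually_eventually_nhds.2 hY] with y hXy hYy
  exact ⟨ContMDiffAt.mlieBracket_vectorField (m := ⊤) (n := ⊤) hXy.self_of_nhds.1
    hYy.self_of_nhds.1 (by simp), IsLocalSection.mlieBracket_mem_derivedDist hXy hYy⟩

/-- The submodule of values at `x` of the smooth local sections of `D`. -/
def localSectionValues (D : ∀ x : N, Submodule ℝ (TangentSpace I x)) (x : N) :
    Submodule ℝ (TangentSpace I x) where
  carrier := {v | ∃ X : ∀ y : N, TangentSpace I y, IsLocalSection I D x X ∧ X x = v}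
  add_mem' := by
    rintro _ _ ⟨X, hX, rfl⟩ ⟨Y, hY, rfl⟩
    refine ⟨X + Y, ?_, rfl⟩
    filter_upwards [hX, hY] with y hXy hYy
    exact ⟨hXy.1.add_section hYy.1, (D y).add_mem hXy.2 hYy.2⟩
  zero_mem' := by
    refine ⟨fun _ => 0, .of_forall fun y => ⟨?_, (D y).zero_mem⟩, rfl⟩
    exact (Bundle.contMDiff_zeroSection ℝ (TangentSpace I : N → Type _)).contMDiffAt
  smul_mem' := by
    rintro c _ ⟨X, hX, rfl⟩
    refine ⟨c • X, ?_, rfl⟩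
    filter_upwards [hX] with y hy
    exact ⟨hy.1.const_smul_section, (D y).smul_mem c hy.2⟩

/-- The derived bundle is a sup of `D` and a span, and the values of sections form a submodule, so
it is enough to treat generators. This supplies frames for the higher derived bundles, for which
total regularity states only constant rank. -/
theorem HasLocalSections.derivedDist [CompleteSpace E]
    {D : ∀ x : N, Submodule ℝ (TangentSpace I x)} (hD : HasLocalSections I D) :
    HasLocalSections I (derivedDist I D) := by
  intro x
  suffices h : GoursatTheory.derivedDist I D x ≤
      localSectionValues (GoursatTheory.derivedDist I D) x from fun v hv => h hv
  refine sup_le (fun v hv => ?_) (Submodule.span_le.2 ?_)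
  · obtain ⟨X, hX, hXv⟩ := hD x v hv
    exact ⟨X, hX.mono (le_derivedDist D), hXv⟩
  · rintro _ ⟨X, Y, hX, hY, rfl⟩
    exact ⟨_, hX.mlieBracket hY, rfl⟩

theorem HasLocalSections.derivedFlag [CompleteSpace E]
    {D : ∀ x : N, Submodule ℝ (TangentSpace I x)} (hD : HasLocalSections I D) (j : ℕ) :
    HasLocalSections I (derivedFlag I D j) := by
  induction j with
  | zero => exact hD
  | succ j ih => exact ih.derivedDist

variable {A : Type*} [NormedAddCommGroup A] [NormedSpace ℝ A] [FiniteDimensional ℝ E]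
  [I.Boundaryless]

/-- Brackets of vector fields which `dπ` maps into `D` are mapped into the derived bundle. -/
theorem mfderiv_lieBracket_mem_derivedDist {π : A → N} {p : A}
    (hπ : ContMDiffAt 𝓘(ℝ, A) I ∞ π p) {D : ∀ y : N, Submodule ℝ (TangentSpace I y)} {r : ℕ}
    (hD : HasRank I D r) (hs : HasLocalSections I D)
    {X X' : A → A} (hX : DifferentiableAt ℝ X p) (hX' : DifferentiableAt ℝ X' p)
    (h : ∀ᶠ x in 𝓝 p, mfderiv 𝓘(ℝ, A) I π x (X x) ∈ D (π x))
    (h' : ∀ᶠ x in 𝓝 p, mfderiv 𝓘(ℝ, A) I π x (X' x) ∈ D (π x)) :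
    mfderiv 𝓘(ℝ, A) I π p (VectorField.lieBracket (E := A) ℝ X X' p) ∈
      derivedDist I D (π p) := by
  have : FiniteDimensional ℝ (TangentSpace I (π p)) := inferInstanceAs (FiniteDimensional ℝ E)
  let b := Module.finBasisOfFinrankEq ℝ (D (π p)) (hD (π p))
  choose Y hY hYb using fun i => hs (π p) (b i) (b i).2
  have hli : LinearIndependent ℝ fun i => Y i (π p) := by
    simp only [hYb]
    exact b.linearIndependent.map' (D (π p)).subtype (Submodule.ker_subtype _)
  have hr : HasRank I D (Fintype.card (Fin r)) := by rwa [Fintype.card_fin]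
  obtain ⟨f, hf, hfX⟩ := exists_differentiableAt_frame_coeff hπ hr hY hli hX h
  obtain ⟨g, hg, hgX⟩ := exists_differentiableAt_frame_coeff hπ hr hY hli hX' h'
  rw [mfderiv_lieBracket_of_eq_sum hπ hX hX' hf hg (fun i => (hY i).self_of_nhds.1) hfX hgX]
  refine Submodule.add_mem _ (Submodule.sum_mem _ fun i _ => Submodule.smul_mem _ _ ?_)
    (Submodule.sum_mem _ fun i _ => Submodule.sum_mem _ fun j _ => Submodule.smul_mem _ _ ?_)
  · exact le_derivedDist D _ (hY i).self_of_nhds.2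
  · exact (hY i).mlieBracket_mem_derivedDist (hY j)

omit [I.Boundaryless] in
/-- If the Cauchy bundle of `D` has corank two in `D`, then `D` has a local frame all but two of
whose members are Cauchy characteristic. -/
theorem exists_frame_of_finrank_cauchyDist {D : ∀ y : N, Submodule ℝ (TangentSpace I y)}
    (hs : HasLocalSections I D) {q : N} {c : ℕ}
    (hc : Module.finrank ℝ (cauchyDist I D q) = c) (hD : Module.finrank ℝ (D q) = c + 2) :
    ∃ Y : Option (Option (Fin c)) → ∀ y : N, TangentSpace I y,
      (∀ i, IsLocalSection I D q (Y i)) ∧ (LinearIndependent ℝ fun i => Y i q) ∧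
      ∀ (i : Fin c) (W : ∀ y : N, TangentSpace I y), IsLocalSection I D q W →
        VectorField.mlieBracket I (Y (some (some i))) W q ∈ D q := by
  have : FiniteDimensional ℝ (TangentSpace I q) := inferInstanceAs (FiniteDimensional ℝ E)
  subst hc
  obtain ⟨z, hz, hli⟩ : ∃ z : Fin (Module.finrank ℝ (cauchyDist I D q)) → TangentSpace I q,
      (∀ i, ∃ X : ∀ y : N, TangentSpace I y, IsLocalSection I D q X ∧
        (∀ᶠ y in 𝓝 q, ∀ Y : ∀ z : N, TangentSpace I z,
          IsLocalSection I D y Y → VectorField.mlieBracket I X Y y ∈ D y) ∧ X q = z i) ∧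
      LinearIndependent ℝ z := by
    -- The basis is chosen among the spanning vectors themselves, so that each member is the value
    -- of a characteristic section.
    obtain ⟨z, hz, -, hli⟩ := Submodule.exists_fun_fin_finrank_span_eq ℝ
      {v | ∃ X : ∀ y : N, TangentSpace I y, IsLocalSection I D q X ∧
        (∀ᶠ y in 𝓝 q, ∀ Y : ∀ z : N, TangentSpace I z,
          IsLocalSection I D y Y → VectorField.mlieBracket I X Y y ∈ D y) ∧ X q = v}
    exact ⟨z, hz, hli⟩
  choose Z hZ hZc hZz using hz
  obtain rfl : (fun i => Z i q) = z := funext hZz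
  have extend : ∀ K : Submodule ℝ (TangentSpace I q),
      Module.finrank ℝ K < Module.finrank ℝ (D q) →
      ∃ W : ∀ y : N, TangentSpace I y, IsLocalSection I D q W ∧ W q ∉ K := by
    intro K hK
    obtain ⟨v, hv, hvK⟩ : ∃ v ∈ D q, v ∉ K := by
      by_contra! h
      exact absurd (Submodule.finrank_mono (show D q ≤ K from h)) (by omega)
    obtain ⟨W, hW, rfl⟩ := hs q v hv
    exact ⟨W, hW, hvK⟩
  obtain ⟨W₁, hW₁, hW₁n⟩ := extend (Submodule.span ℝ (Set.range fun i => Z i q)) (by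
    rw [finrank_span_eq_card hli, hD, Fintype.card_fin]
    exact Nat.lt_add_of_pos_right two_pos)
  have hli₁ := linearIndependent_option'.2 ⟨hli, hW₁n⟩
  obtain ⟨W₂, hW₂, hW₂n⟩ := extend _ (by
    rw [finrank_span_eq_card hli₁, hD, Fintype.card_option, Fintype.card_fin]
    exact Nat.lt_succ_self _)
  have hli₂ := linearIndependent_option'.2 ⟨hli₁, hW₂n⟩
  refine ⟨fun o => o.casesOn' W₂ fun o => o.casesOn' W₁ Z, ?_, ?_, ?_⟩
  · rintro (_ | _ | i)
    exacts [hW₂, hW₁, hZ i]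
  · have e : (fun o : Option (Option (Fin (Module.finrank ℝ (cauchyDist I D q)))) =>
        (o.casesOn' W₂ fun o => o.casesOn' W₁ Z : ∀ y : N, TangentSpace I y) q) =
        fun o => o.casesOn' (W₂ q) fun o => o.casesOn' (W₁ q) fun i => Z i q := by
      funext o
      rcases o with _ | _ | i <;> rfl
    rw [e]
    exact hli₂
  · exact fun i W hW => (hZc i).self_of_nhds W hW

/-- If the Cauchy bundle of `D` has corank two in `D`, then the structure tensor of `D`, composed
with a linear form, is decomposable and satisfies the Plücker relation. -/
theorem structure_plucker {π : A → N} {p : A}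
    (hπ : ContMDiffAt 𝓘(ℝ, A) I ∞ π p) {D : ∀ y : N, Submodule ℝ (TangentSpace I y)} {c : ℕ}
    (hD : HasRank I D (c + 2)) (hs : HasLocalSections I D)
    (hc : Module.finrank ℝ (cauchyDist I D (π p)) = c)
    {X₁ X₂ X₃ X₄ : A → A} (hX₁ : DifferentiableAt ℝ X₁ p) (hX₂ : DifferentiableAt ℝ X₂ p)
    (hX₃ : DifferentiableAt ℝ X₃ p) (hX₄ : DifferentiableAt ℝ X₄ p)
    (h₁ : ∀ᶠ x in 𝓝 p, mfderiv 𝓘(ℝ, A) I π x (X₁ x) ∈ D (π x))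
    (h₂ : ∀ᶠ x in 𝓝 p, mfderiv 𝓘(ℝ, A) I π x (X₂ x) ∈ D (π x))
    (h₃ : ∀ᶠ x in 𝓝 p, mfderiv 𝓘(ℝ, A) I π x (X₃ x) ∈ D (π x))
    (h₄ : ∀ᶠ x in 𝓝 p, mfderiv 𝓘(ℝ, A) I π x (X₄ x) ∈ D (π x))
    (μ : TangentSpace I (π p) →ₗ[ℝ] ℝ) (hμ : D (π p) ≤ LinearMap.ker μ)
    (ν : A →ₗ[ℝ] ℝ) (hν : ∀ v : A, ν v = μ (mfderiv 𝓘(ℝ, A) I π p v)) :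
    ν (VectorField.lieBracket ℝ X₁ X₂ p) * ν (VectorField.lieBracket ℝ X₃ X₄ p) -
      ν (VectorField.lieBracket ℝ X₁ X₃ p) * ν (VectorField.lieBracket ℝ X₂ X₄ p) +
      ν (VectorField.lieBracket ℝ X₁ X₄ p) * ν (VectorField.lieBracket ℝ X₂ X₃ p) = 0 := by
  obtain ⟨Y, hY, hli, hYc⟩ := exists_frame_of_finrank_cauchyDist hs hc (hD (π p))
  have hr : HasRank I D (Fintype.card (Option (Option (Fin c)))) := by
    simpa using hD
  have hμD : ∀ v ∈ D (π p), μ v = 0 := fun v hv => hμ hv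
  have coeff : ∀ {X : A → A}, DifferentiableAt ℝ X p →
      (∀ᶠ x in 𝓝 p, mfderiv 𝓘(ℝ, A) I π x (X x) ∈ D (π x)) →
      ∃ f : Option (Option (Fin c)) → A → ℝ, (∀ i, DifferentiableAt ℝ (f i) p) ∧
      ∀ᶠ x in 𝓝 p, mfderiv 𝓘(ℝ, A) I π x (X x) = ∑ i, f i x • Y i (π x) :=
    fun hX h => exists_differentiableAt_frame_coeff hπ hr hY hli hX h
  -- The derivative terms lie in `D` and die under `μ`, as do brackets with characteristic frame
  -- fields. Only the pair `none`, `some none` survives, with a 2×2 minor as coefficient; the claim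
  -- is the Plücker identity between the minors of a 2×4 matrix.
  have bracket : ∀ {X X' : A → A} {f g : Option (Option (Fin c)) → A → ℝ},
      DifferentiableAt ℝ X p → DifferentiableAt ℝ X' p →
      (∀ i, DifferentiableAt ℝ (f i) p) → (∀ i, DifferentiableAt ℝ (g i) p) →
      (∀ᶠ x in 𝓝 p, mfderiv 𝓘(ℝ, A) I π x (X x) = ∑ i, f i x • Y i (π x)) →
      (∀ᶠ x in 𝓝 p, mfderiv 𝓘(ℝ, A) I π x (X' x) = ∑ i, g i x • Y i (π x)) →
      ν (VectorField.lieBracket ℝ X X' p) =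
        (f none p * g (some none) p - f (some none) p * g none p) *
          μ (VectorField.mlieBracket I (Y none) (Y (some none)) (π p)) := by
    intro X X' f g hX hX' hf hg hfX hgX
    have e1 : ∀ i j, μ (VectorField.mlieBracket I (Y i) (Y j) (π p)) =
        -μ (VectorField.mlieBracket I (Y j) (Y i) (π p)) := fun i j => by
      rw [VectorField.mlieBracket_swap_apply, map_neg]
    have e2 : ∀ i j, μ (VectorField.mlieBracket I (Y (some (some i))) (Y j) (π p)) = 0 :=
      fun i j => hμD _ (hYc i (Y j) (hY j))
    have e3 : ∀ i j, μ (VectorField.mlieBracket I (Y j) (Y (some (some i))) (π p)) = 0 :=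
      fun i j => by rw [e1, e2, neg_zero]
    have e4 : ∀ i, μ (VectorField.mlieBracket I (Y i) (Y i) (π p)) = 0 :=
      fun i => by linarith [e1 i i]
    have e5 : ∀ i, μ (Y i (π p)) = 0 := fun i => hμD _ (hY i).self_of_nhds.2
    rw [hν, mfderiv_lieBracket_of_eq_sum hπ hX hX' hf hg (fun i => (hY i).self_of_nhds.1) hfX hgX]
    simp only [map_add, map_sum, map_smul, e5, Finset.sum_const_zero, zero_add,
      Fintype.sum_option, e2, e3, e4, smul_eq_mul, mul_zero, add_zero]
    rw [e1 (some none) none]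
    ring
  obtain ⟨f₁, hf₁, hX₁f⟩ := coeff hX₁ h₁
  obtain ⟨f₂, hf₂, hX₂f⟩ := coeff hX₂ h₂
  obtain ⟨f₃, hf₃, hX₃f⟩ := coeff hX₃ h₃
  obtain ⟨f₄, hf₄, hX₄f⟩ := coeff hX₄ h₄
  rw [bracket hX₁ hX₂ hf₁ hf₂ hX₁f hX₂f, bracket hX₃ hX₄ hf₃ hf₄ hX₃f hX₄f,
    bracket hX₁ hX₃ hf₁ hf₃ hX₁f hX₃f, bracket hX₂ hX₄ hf₂ hf₄ hX₂f hX₄f,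
    bracket hX₁ hX₄ hf₁ hf₄ hX₁f hX₄f, bracket hX₂ hX₃ hf₂ hf₃ hX₂f hX₃f]
  ring

end DerivedFlag

/-! ### Derivatives of fields given by their state components. -/

section StateField

variable {n m : ℕ}

/-- The vector field with constant time component `c`, state components `x` and no control
component. -/
def stateField (c : ℝ) (x : Fin n → TXU n m → ℝ) (p : TXU n m) : TXU n m :=
  (c, WithLp.toLp 2 fun i => x i p, 0)

theorem hasFDerivAt_stateField (c : ℝ) {x : Fin n → TXU n m → ℝ} {p : TXU n m}
    (hx : ∀ i, DifferentiableAt ℝ (x i) p) :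
    HasFDerivAt (stateField c x)
      ((0 : TXU n m →L[ℝ] ℝ).prod
        ((((EuclideanSpace.equiv (Fin n) ℝ).symm : (Fin n → ℝ) →L[ℝ] _).comp
          (ContinuousLinearMap.pi fun i => fderiv ℝ (x i) p)).prod 0)) p :=
  (hasFDerivAt_const c p).prodMk
    (((EuclideanSpace.equiv (Fin n) ℝ).symm.toContinuousLinearMap.hasFDerivAt.comp p
      (hasFDerivAt_pi.2 fun i => (hx i).hasFDerivAt)).prodMk (hasFDerivAt_const 0 p))

theorem fderiv_stateField (c : ℝ) {x : Fin n → TXU n m → ℝ} {p : TXU n m}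
    (hx : ∀ i, DifferentiableAt ℝ (x i) p) (v : TXU n m) :
    fderiv ℝ (stateField c x) p v = (0, WithLp.toLp 2 fun i => fderiv ℝ (x i) p v, 0) := by
  rw [(hasFDerivAt_stateField c hx).fderiv]
  rfl

theorem fderiv_state (i : Fin n) (p v : TXU n m) :
    fderiv ℝ (fun q : TXU n m => q.2.1 i) p v = v.2.1 i := by
  let L : TXU n m →L[ℝ] ℝ := (EuclideanSpace.proj (𝕜 := ℝ) i).comp
    ((ContinuousLinearMap.fst ℝ _ _).comp (ContinuousLinearMap.snd ℝ _ _))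
  exact congrArg (fun K : TXU n m →L[ℝ] ℝ => K v) (L.hasFDerivAt (x := p)).fderiv

theorem fderiv_control (i : Fin m) (p v : TXU n m) :
    fderiv ℝ (fun q : TXU n m => q.2.2 i) p v = v.2.2 i := by
  let L : TXU n m →L[ℝ] ℝ := (EuclideanSpace.proj (𝕜 := ℝ) i).comp
    ((ContinuousLinearMap.snd ℝ _ _).comp (ContinuousLinearMap.snd ℝ _ _))
  exact congrArg (fun K : TXU n m →L[ℝ] ℝ => K v) (L.hasFDerivAt (x := p)).fderiv

end StateField

/-! ### The PVTOL fields and their derivatives. -/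

section PVTOL

open Real

/-- The drift `∂ₜ + ∑ fⁱ ∂_{xⁱ}` of the PVTOL system. -/
def pvtolT (h g lam : ℝ) : TXU 6 2 → TXU 6 2 :=
  stateField 1 ![fun p => p.2.1 1,
    fun p => -p.2.2 0 * sin (p.2.1 4) + h * p.2.2 1 * cos (p.2.1 4),
    fun p => p.2.1 3,
    fun p => p.2.2 0 * cos (p.2.1 4) + h * p.2.2 1 * sin (p.2.1 4) - g,
    fun p => p.2.1 5,
    fun p => lam * p.2.2 1]

/-- `-sin θ ∂_ẋ + cos θ ∂_ż`. -/
def pvtolB₁ : TXU 6 2 → TXU 6 2 :=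
  stateField 0 ![fun _ => 0, fun p => -sin (p.2.1 4), fun _ => 0, fun p => cos (p.2.1 4),
    fun _ => 0, fun _ => 0]

/-- `h (cos θ ∂_ẋ + sin θ ∂_ż) + λ ∂_θ̇`. -/
def pvtolB₂ (h lam : ℝ) : TXU 6 2 → TXU 6 2 :=
  stateField 0 ![fun _ => 0, fun p => h * cos (p.2.1 4), fun _ => 0, fun p => h * sin (p.2.1 4),
    fun _ => 0, fun _ => lam]

/-- `sin θ ∂_x - cos θ ∂_z - θ̇ (cos θ ∂_ẋ + sin θ ∂_ż)`. -/
def pvtolC₁ : TXU 6 2 → TXU 6 2 :=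
  stateField 0 ![fun p => sin (p.2.1 4), fun p => -p.2.1 5 * cos (p.2.1 4),
    fun p => -cos (p.2.1 4), fun p => -p.2.1 5 * sin (p.2.1 4), fun _ => 0, fun _ => 0]

/-- `h (cos θ ∂_x + sin θ ∂_z) + λ ∂_θ`. -/
def pvtolC₂ (h lam : ℝ) : TXU 6 2 → TXU 6 2 :=
  stateField 0 ![fun p => h * cos (p.2.1 4), fun _ => 0, fun p => h * sin (p.2.1 4), fun _ => 0,
    fun _ => lam, fun _ => 0]

/-- `cos θ ∂_ẋ + sin θ ∂_ż`. -/
def pvtolE : TXU 6 2 → TXU 6 2 :=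
  stateField 0 ![fun _ => 0, fun p => cos (p.2.1 4), fun _ => 0, fun p => sin (p.2.1 4),
    fun _ => 0, fun _ => 0]

/-- `cos θ ∂_x + sin θ ∂_z`. -/
def pvtolA : TXU 6 2 → TXU 6 2 :=
  stateField 0 ![fun p => cos (p.2.1 4), fun _ => 0, fun p => sin (p.2.1 4), fun _ => 0,
    fun _ => 0, fun _ => 0]

/-- The control direction `∂_{uᵃ}`. -/
def controlVec (a : Fin 2) : TXU 6 2 := (0, 0, EuclideanSpace.single a 1)

theorem pvtolT_eq (h g lam : ℝ) (p : TXU 6 2) : pvtolT h g lam p = (1, pvtol h g lam p, 0) := by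
  ext i
  · rfl
  · fin_cases i <;> rfl
  · rfl

theorem differentiable_pvtolT (h g lam : ℝ) : Differentiable ℝ (pvtolT h g lam) := fun _ =>
  (hasFDerivAt_stateField _ fun i => by fin_cases i <;> simp <;> fun_prop).differentiableAt

theorem fderiv_pvtolT (h g lam : ℝ) (p v : TXU 6 2) :
    fderiv ℝ (pvtolT h g lam) p v = (0, !₂[v.2.1 1,
      -v.2.2 0 * sin (p.2.1 4) - p.2.2 0 * (cos (p.2.1 4) * v.2.1 4) +
        h * v.2.2 1 * cos (p.2.1 4) - h * p.2.2 1 * (sin (p.2.1 4) * v.2.1 4),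
      v.2.1 3,
      v.2.2 0 * cos (p.2.1 4) - p.2.2 0 * (sin (p.2.1 4) * v.2.1 4) +
        h * v.2.2 1 * sin (p.2.1 4) + h * p.2.2 1 * (cos (p.2.1 4) * v.2.1 4),
      v.2.1 5,
      lam * v.2.2 1], 0) := by
  rw [pvtolT, fderiv_stateField _ fun i => by fin_cases i <;> simp <;> fun_prop]
  ext i
  · rfl
  · fin_cases i <;>
      simp (disch := fun_prop) [fderiv_fun_mul, fderiv_fun_add, fderiv_fun_sub, fderiv_state,
        fderiv_control] <;> ring
  · rfl

theorem differentiable_pvtolB₁ : Differentiable ℝ pvtolB₁ := fun _ =>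
  (hasFDerivAt_stateField _ fun i => by fin_cases i <;> simp <;> fun_prop).differentiableAt

theorem fderiv_pvtolB₁ (p v : TXU 6 2) :
    fderiv ℝ pvtolB₁ p v = (0, !₂[0,
      -(cos (p.2.1 4) * v.2.1 4),
      0,
      -(sin (p.2.1 4) * v.2.1 4),
      0,
      0], 0) := by
  rw [pvtolB₁, fderiv_stateField _ fun i => by fin_cases i <;> simp <;> fun_prop]
  ext i
  · rfl
  · fin_cases i <;> simp (disch := fun_prop) [fderiv_state]
  · rfl

theorem differentiable_pvtolB₂ (h lam : ℝ) : Differentiable ℝ (pvtolB₂ h lam) := fun _ =>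
  (hasFDerivAt_stateField _ fun i => by fin_cases i <;> simp <;> fun_prop).differentiableAt

theorem fderiv_pvtolB₂ (h lam : ℝ) (p v : TXU 6 2) :
    fderiv ℝ (pvtolB₂ h lam) p v = (0, !₂[0,
      -(h * (sin (p.2.1 4) * v.2.1 4)),
      0,
      h * (cos (p.2.1 4) * v.2.1 4),
      0,
      0], 0) := by
  rw [pvtolB₂, fderiv_stateField _ fun i => by fin_cases i <;> simp <;> fun_prop]
  ext i
  · rfl
  · fin_cases i <;> simp (disch := fun_prop) [fderiv_fun_mul, fderiv_state]
  · rfl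

theorem differentiable_pvtolC₁ : Differentiable ℝ pvtolC₁ := fun _ =>
  (hasFDerivAt_stateField _ fun i => by fin_cases i <;> simp <;> fun_prop).differentiableAt

theorem fderiv_pvtolC₁ (p v : TXU 6 2) :
    fderiv ℝ pvtolC₁ p v = (0, !₂[cos (p.2.1 4) * v.2.1 4,
      -v.2.1 5 * cos (p.2.1 4) + p.2.1 5 * (sin (p.2.1 4) * v.2.1 4),
      sin (p.2.1 4) * v.2.1 4,
      -v.2.1 5 * sin (p.2.1 4) - p.2.1 5 * (cos (p.2.1 4) * v.2.1 4),
      0,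
      0], 0) := by
  rw [pvtolC₁, fderiv_stateField _ fun i => by fin_cases i <;> simp <;> fun_prop]
  ext i
  · rfl
  · fin_cases i <;>
      simp (disch := fun_prop) [fderiv_fun_mul, fderiv_state] <;> ring
  · rfl

theorem differentiable_pvtolC₂ (h lam : ℝ) : Differentiable ℝ (pvtolC₂ h lam) := fun _ =>
  (hasFDerivAt_stateField _ fun i => by fin_cases i <;> simp <;> fun_prop).differentiableAt

theorem fderiv_pvtolC₂ (h lam : ℝ) (p v : TXU 6 2) :
    fderiv ℝ (pvtolC₂ h lam) p v = (0, !₂[-(h * (sin (p.2.1 4) * v.2.1 4)),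
      0,
      h * (cos (p.2.1 4) * v.2.1 4),
      0,
      0,
      0], 0) := by
  rw [pvtolC₂, fderiv_stateField _ fun i => by fin_cases i <;> simp <;> fun_prop]
  ext i
  · rfl
  · fin_cases i <;> simp (disch := fun_prop) [fderiv_fun_mul, fderiv_state]
  · rfl

theorem differentiable_pvtolE : Differentiable ℝ pvtolE := fun _ =>
  (hasFDerivAt_stateField _ fun i => by fin_cases i <;> simp <;> fun_prop).differentiableAt

theorem fderiv_pvtolE (p v : TXU 6 2) :
    fderiv ℝ pvtolE p v = (0, !₂[0,
      -(sin (p.2.1 4) * v.2.1 4),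
      0,
      cos (p.2.1 4) * v.2.1 4,
      0,
      0], 0) := by
  rw [pvtolE, fderiv_stateField _ fun i => by fin_cases i <;> simp <;> fun_prop]
  ext i
  · rfl
  · fin_cases i <;> simp (disch := fun_prop) [fderiv_state]
  · rfl

/-! ### Bracket table of the PVTOL fields. -/

theorem lieBracket_control_zero_T (h g lam : ℝ) (p : TXU 6 2) :
    VectorField.lieBracket ℝ (fun _ => controlVec 0) (pvtolT h g lam) p =
      pvtolB₁ p := by
  simp only [VectorField.lieBracket_eq, fderiv_pvtolT]
  ext i
  · simp [controlVec, pvtolB₁, pvtolT, stateField]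
  · fin_cases i <;> simp [controlVec, pvtolB₁, pvtolT, stateField]
  · simp [controlVec, pvtolB₁, pvtolT, stateField]

theorem lieBracket_control_one_T (h g lam : ℝ) (p : TXU 6 2) :
    VectorField.lieBracket ℝ (fun _ => controlVec 1) (pvtolT h g lam) p =
      pvtolB₂ h lam p := by
  simp only [VectorField.lieBracket_eq, fderiv_pvtolT]
  ext i
  · simp [controlVec, pvtolB₂, pvtolT, stateField]
  · fin_cases i <;> simp [controlVec, pvtolB₂, pvtolT, stateField]
  · simp [controlVec, pvtolB₂, pvtolT, stateField]

theorem lieBracket_T_B₁ (h g lam : ℝ) (p : TXU 6 2) :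
    VectorField.lieBracket ℝ (pvtolT h g lam) pvtolB₁ p =
      pvtolC₁ p := by
  simp only [VectorField.lieBracket_eq, fderiv_pvtolB₁, fderiv_pvtolT]
  ext i
  · simp [pvtolB₁, pvtolC₁, pvtolT, stateField]
  · fin_cases i <;> simp [pvtolB₁, pvtolC₁, pvtolT, stateField] <;> ring
  · simp [pvtolB₁, pvtolC₁, pvtolT, stateField]

theorem lieBracket_T_B₂ (h g lam : ℝ) (p : TXU 6 2) :
    VectorField.lieBracket ℝ (pvtolT h g lam) (pvtolB₂ h lam) p =
      (h * p.2.1 5) • pvtolB₁ p - pvtolC₂ h lam p := by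
  simp only [VectorField.lieBracket_eq, fderiv_pvtolB₂, fderiv_pvtolT]
  ext i
  · simp [pvtolB₁, pvtolB₂, pvtolC₂, pvtolT, stateField]
  · fin_cases i <;> simp [pvtolB₁, pvtolB₂, pvtolC₂, pvtolT, stateField] <;> ring
  · simp [pvtolB₁, pvtolB₂, pvtolC₂, pvtolT, stateField]

theorem lieBracket_B₁_B₂ (h lam : ℝ) (p : TXU 6 2) :
    VectorField.lieBracket ℝ pvtolB₁ (pvtolB₂ h lam) p =
      0 := by
  simp only [VectorField.lieBracket_eq, fderiv_pvtolB₁, fderiv_pvtolB₂]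
  ext i
  · simp [pvtolB₁, pvtolB₂, stateField]
  · fin_cases i <;> simp [pvtolB₁, pvtolB₂, stateField]
  · simp [pvtolB₁, pvtolB₂, stateField]

theorem lieBracket_B₁_C₁ (p : TXU 6 2) :
    VectorField.lieBracket ℝ pvtolB₁ pvtolC₁ p =
      0 := by
  simp only [VectorField.lieBracket_eq, fderiv_pvtolB₁, fderiv_pvtolC₁]
  ext i
  · simp [pvtolB₁, pvtolC₁, stateField]
  · fin_cases i <;> simp [pvtolB₁, pvtolC₁, stateField]
  · simp [pvtolB₁, pvtolC₁, stateField]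

theorem lieBracket_B₁_C₂ (h lam : ℝ) (p : TXU 6 2) :
    VectorField.lieBracket ℝ pvtolB₁ (pvtolC₂ h lam) p =
      lam • pvtolE p := by
  simp only [VectorField.lieBracket_eq, fderiv_pvtolB₁, fderiv_pvtolC₂]
  ext i
  · simp [pvtolB₁, pvtolC₂, pvtolE, stateField]
  · fin_cases i <;> simp [pvtolB₁, pvtolC₂, pvtolE, stateField, mul_comm]
  · simp [pvtolB₁, pvtolC₂, pvtolE, stateField]

/-- Together with `[B₁, C₂] = λE` and `[B₁, B₂] = [B₁, C₁] = 0`, this is what the Plücker relation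
cannot tolerate unless `E` is killed. -/
theorem lieBracket_B₂_C₁ (h lam : ℝ) (p : TXU 6 2) :
    VectorField.lieBracket ℝ (pvtolB₂ h lam) pvtolC₁ p =
      -(lam • pvtolE p) := by
  simp only [VectorField.lieBracket_eq, fderiv_pvtolB₂, fderiv_pvtolC₁]
  ext i
  · simp [pvtolB₂, pvtolC₁, pvtolE, stateField]
  · fin_cases i <;> simp [pvtolB₂, pvtolC₁, pvtolE, stateField]
  · simp [pvtolB₂, pvtolC₁, pvtolE, stateField]

theorem lieBracket_C₂_C₁ (h lam : ℝ) (p : TXU 6 2) :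
    VectorField.lieBracket ℝ (pvtolC₂ h lam) pvtolC₁ p =
      lam • pvtolA p - (lam * p.2.1 5) • pvtolB₁ p := by
  simp only [VectorField.lieBracket_eq, fderiv_pvtolC₁, fderiv_pvtolC₂]
  ext i
  · simp [pvtolA, pvtolB₁, pvtolC₁, pvtolC₂, stateField]
  · fin_cases i <;> simp [pvtolA, pvtolB₁, pvtolC₁, pvtolC₂, stateField] <;> ring
  · simp [pvtolA, pvtolB₁, pvtolC₁, pvtolC₂, stateField]

/-- Modulo `B₁` this is `−A`, while `[C₂, C₁]` is `λA`: their product gives the square of the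
`A`-component. -/
theorem lieBracket_T_E (h g lam : ℝ) (p : TXU 6 2) :
    VectorField.lieBracket ℝ (pvtolT h g lam) pvtolE p =
      p.2.1 5 • pvtolB₁ p - pvtolA p := by
  simp only [VectorField.lieBracket_eq, fderiv_pvtolE, fderiv_pvtolT]
  ext i
  · simp [pvtolA, pvtolB₁, pvtolE, pvtolT, stateField]
  · fin_cases i <;> simp [pvtolA, pvtolB₁, pvtolE, pvtolT, stateField] <;> ring
  · simp [pvtolA, pvtolB₁, pvtolE, pvtolT, stateField]

theorem lieBracket_E_C₁ (p : TXU 6 2) :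
    VectorField.lieBracket ℝ pvtolE pvtolC₁ p =
      0 := by
  simp only [VectorField.lieBracket_eq, fderiv_pvtolC₁, fderiv_pvtolE]
  ext i
  · simp [pvtolC₁, pvtolE, stateField]
  · fin_cases i <;> simp [pvtolC₁, pvtolE, stateField]
  · simp [pvtolC₁, pvtolE, stateField]

theorem lieBracket_E_C₂ (h lam : ℝ) (p : TXU 6 2) :
    VectorField.lieBracket ℝ pvtolE (pvtolC₂ h lam) p =
      -(lam • pvtolB₁ p) := by
  simp only [VectorField.lieBracket_eq, fderiv_pvtolC₂, fderiv_pvtolE]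
  ext i
  · simp [pvtolB₁, pvtolC₂, pvtolE, stateField]
  · fin_cases i <;> simp [pvtolB₁, pvtolC₂, pvtolE, stateField, mul_comm]
  · simp [pvtolB₁, pvtolC₂, pvtolE, stateField]

end PVTOL

/-! ### The PVTOL fields span the tangent space. -/

section PVTOLSpan

open Real

/-- The PVTOL fields `T`, `∂_{uᵃ}`, `B₁`, `B₂`, `C₁`, `C₂`, `E`, `A` span the tangent space. -/
theorem eq_top_of_pvtol_mem {h g lam : ℝ} (hlam : lam ≠ 0) {p : TXU 6 2}
    {S : Submodule ℝ (TXU 6 2)} (hT : pvtolT h g lam p ∈ S) (hU₀ : controlVec 0 ∈ S)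
    (hU₁ : controlVec 1 ∈ S) (hB₁ : pvtolB₁ p ∈ S) (hB₂ : pvtolB₂ h lam p ∈ S)
    (hC₁ : pvtolC₁ p ∈ S) (hC₂ : pvtolC₂ h lam p ∈ S) (hE : pvtolE p ∈ S) (hA : pvtolA p ∈ S) :
    S = ⊤ := by
  refine eq_top_iff.2 fun v _ => ?_
  have hsc := sin_sq_add_cos_sq (p.2.1 4)
  set s := sin (p.2.1 4) with hs
  set c := cos (p.2.1 4) with hc
  -- The system is solved triangularly. The `θ` and `θ̇` components give `κ` and `β`; the position
  -- residue `(a, b)` and then the velocity residue `(d, e)` are resolved in the frame rotated by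
  -- `θ`.
  obtain ⟨κ, hκ⟩ : ∃ κ, κ * lam = v.2.1 4 - v.1 * p.2.1 5 := ⟨_, div_mul_cancel₀ _ hlam⟩
  obtain ⟨β, hβ⟩ : ∃ β, β * lam = v.2.1 5 - v.1 * (lam * p.2.2 1) := ⟨_, div_mul_cancel₀ _ hlam⟩
  obtain ⟨a, ha⟩ : ∃ a, a = v.2.1 0 - v.1 * p.2.1 1 - κ * (h * c) := ⟨_, rfl⟩
  obtain ⟨b, hb⟩ : ∃ b, b = v.2.1 2 - v.1 * p.2.1 3 - κ * (h * s) := ⟨_, rfl⟩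
  obtain ⟨d, hd⟩ : ∃ d, d = v.2.1 1 - v.1 * (-p.2.2 0 * s + h * p.2.2 1 * c) - β * (h * c) +
    (s * a - c * b) * (p.2.1 5 * c) := ⟨_, rfl⟩
  obtain ⟨e, he⟩ : ∃ e, e = v.2.1 3 - v.1 * (p.2.2 0 * c + h * p.2.2 1 * s - g) - β * (h * s) +
    (s * a - c * b) * (p.2.1 5 * s) := ⟨_, rfl⟩
  have key : v = v.1 • pvtolT h g lam p + v.2.2 0 • controlVec 0 + v.2.2 1 • controlVec 1 +
      (c * e - s * d) • pvtolB₁ p + β • pvtolB₂ h lam p + (s * a - c * b) • pvtolC₁ p +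
      κ • pvtolC₂ h lam p + (c * d + s * e) • pvtolE p + (c * a + s * b) • pvtolA p := by
    ext i
    · simp [pvtolT, pvtolB₁, pvtolB₂, pvtolC₁, pvtolC₂, pvtolE, pvtolA, controlVec, stateField]
    · fin_cases i <;> simp [pvtolT, pvtolB₁, pvtolB₂, pvtolC₁, pvtolC₂, pvtolE, pvtolA,
        controlVec, stateField, ← hs, ← hc]
      · linear_combination -ha - a * hsc
      · linear_combination -hd - d * hsc
      · linear_combination -hb - b * hsc
      · linear_combination -he - e * hsc
      · linear_combination -hκ
      · linear_combination -hβ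
    · fin_cases i <;> simp [pvtolT, pvtolB₁, pvtolB₂, pvtolC₁, pvtolC₂, pvtolE, pvtolA,
        controlVec, stateField]
  rw [key]
  exact S.add_mem (S.add_mem (S.add_mem (S.add_mem (S.add_mem (S.add_mem (S.add_mem (S.add_mem
    (S.smul_mem _ hT) (S.smul_mem _ hU₀)) (S.smul_mem _ hU₁)) (S.smul_mem _ hB₁))
    (S.smul_mem _ hB₂)) (S.smul_mem _ hC₁)) (S.smul_mem _ hC₂)) (S.smul_mem _ hE))
    (S.smul_mem _ hA)

theorem pvtolT_mem_controlDist (h g lam : ℝ) (p : TXU 6 2) :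
    pvtolT h g lam p ∈ (controlDist (pvtol h g lam) p : Submodule ℝ (TXU 6 2)) := by
  rw [pvtolT_eq]
  have hmem : ((1, pvtol h g lam p, 0) : TXU 6 2) ∈ Submodule.span ℝ
      (insert ((1, pvtol h g lam p, 0) : TXU 6 2)
        (Set.range fun a : Fin 2 => ((0, 0, EuclideanSpace.single a 1) : TXU 6 2))) :=
    Submodule.subset_span (Set.mem_insert _ _)
  exact hmem

theorem controlVec_mem_controlDist (h g lam : ℝ) (a : Fin 2) (p : TXU 6 2) :
    controlVec a ∈ (controlDist (pvtol h g lam) p : Submodule ℝ (TXU 6 2)) := by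
  have hmem : controlVec a ∈ Submodule.span ℝ
      (insert ((1, pvtol h g lam p, 0) : TXU 6 2)
        (Set.range fun a : Fin 2 => ((0, 0, EuclideanSpace.single a 1) : TXU 6 2))) :=
    Submodule.subset_span (Set.mem_insert_of_mem _ ⟨a, rfl⟩)
  exact hmem

end PVTOLSpan

/-! ### The quotient distribution and its rank. -/

section Quotient

variable {n m d : ℕ} {N : Type*} [TopologicalSpace N] [ChartedSpace (EuclideanSpace ℝ (Fin d)) N]

theorem finrank_controlDist_le (f : TXU n m → EuclideanSpace ℝ (Fin n)) (p : TXU n m) :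
    Module.finrank ℝ (controlDist f p) ≤ m + 1 := by
  classical
  have h := finrank_span_finset_le_card (R := ℝ) (insert ((1, f p, 0) : TXU n m)
    (Finset.univ.image fun a : Fin m => ((0, 0, EuclideanSpace.single a 1) : TXU n m)))
  rw [Finset.coe_insert, Finset.coe_image, Finset.coe_univ, Set.image_univ] at h
  refine h.trans ((Finset.card_insert_le _ _).trans (Nat.succ_le_succ ?_))
  exact Finset.card_image_le.trans (by simp)

theorem mfderiv_mem_quotientDist {V : ∀ p : TXU n m, Submodule ℝ (TangentSpace 𝓘(ℝ, TXU n m) p)}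
    {M : Set (TXU n m)} {π : TXU n m → N} {p : TXU n m} (hp : p ∈ M) {v : TXU n m}
    (hv : v ∈ (V p : Submodule ℝ (TXU n m))) :
    mfderiv 𝓘(ℝ, TXU n m) (𝓡 d) π p v ∈ quotientDist V M π (π p) :=
  Submodule.subset_span ⟨⟨p, v⟩, hp, hv, rfl⟩

/-- By invariance, the fibre of the quotient distribution at `π p` is the image of the fibre of the
control distribution at `p`. -/
theorem quotientDist_le_map {f : TXU n m → EuclideanSpace ℝ (Fin n)} {M : Set (TXU n m)}
    (hM : IsOpen M) {φ : ℝ → TXU n m → TXU n m} (hφ : IsControlAdmissible f M φ)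
    {π : TXU n m → N} (hπ : IsOrbitSpace (d := d) M φ π) {p : TXU n m} (hp : p ∈ M) :
    quotientDist (d := d) (controlDist f) M π (π p) ≤
      (controlDist f p).map (mfderiv 𝓘(ℝ, TXU n m) (𝓡 d) π p).toLinearMap := by
  refine Submodule.span_le.2 ?_
  rintro w ⟨⟨p', v⟩, hp', hv, hvw⟩
  have hpp : π p' = π p := congrArg Bundle.TotalSpace.proj hvw
  obtain ⟨s, rfl⟩ := (hπ.fibres p hp p' hp').1 hpp.symm
  have hv' : v ∈ Submodule.map (fderiv ℝ (φ s) p : TXU n m →ₗ[ℝ] TXU n m) (controlDist f p) := by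
    rw [hφ.symmetry s p hp]
    exact hv
  obtain ⟨v₀, hv₀, rfl⟩ := hv'
  refine ⟨v₀, hv₀, ?_⟩
  have hφd : DifferentiableAt ℝ (φ s) p := by
    have h1 : ContDiffAt ℝ ∞ (fun y : ℝ × TXU n m => φ y.1 y.2) (s, p) :=
      hφ.smooth.contDiffAt ((isOpen_univ.prod hM).mem_nhds ⟨trivial, hp⟩)
    exact (h1.differentiableAt (by simp)).comp p
      (f := fun y : TXU n m => ((s, y) : ℝ × TXU n m)) (by fun_prop)
  have hπd : MDifferentiableAt 𝓘(ℝ, TXU n m) (𝓡 d) π (φ s p) :=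
    (hπ.smooth.contMDiffAt (hM.mem_nhds hp')).mdifferentiableAt (by simp)
  -- Differentiating `π ∘ φ s = π` shows that the vector `v` at `φ s p` and its preimage `v₀` at `p`
  -- have the same image, so the other points of the orbit add nothing.
  have hcomp : π ∘ φ s =ᶠ[𝓝 p] π := by
    filter_upwards [hM.mem_nhds hp] with x hx
    exact ((hπ.fibres x hx _ (hφ.mapsTo s hx)).2 ⟨s, rfl⟩).symm
  have h1 := mfderiv_comp p hπd hφd.mdifferentiableAt
  have h2 : (mfderiv 𝓘(ℝ, TXU n m) (𝓡 d) π p v₀ : EuclideanSpace ℝ (Fin d)) =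
      mfderiv 𝓘(ℝ, TXU n m) (𝓡 d) π (φ s p) (fderiv ℝ (φ s) p v₀) := by
    rw [← mfderiv_eq_fderiv]
    have h3 := hcomp.mfderiv_eq (I := 𝓘(ℝ, TXU n m)) (I' := 𝓡 d)
    have h4 : (mfderiv 𝓘(ℝ, TXU n m) (𝓡 d) (π ∘ φ s) p v₀ : EuclideanSpace ℝ (Fin d)) =
      mfderiv 𝓘(ℝ, TXU n m) (𝓡 d) π p v₀ := congrArg
        (fun L : TXU n m →L[ℝ] EuclideanSpace ℝ (Fin d) => L v₀) h3
    rw [← h4, h1]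
    rfl
  refine h2.trans ?_
  exact eq_of_heq (Bundle.TotalSpace.mk.inj hvw).2

end Quotient

/-! ### Numerics of the signature. -/

theorem brunovskyVelocity_antitone (k : ℕ) (ρ : ℕ → ℕ) : Antitone (brunovskyVelocity k ρ) :=
  fun _ _ h => Finset.sum_le_sum_of_subset (Finset.Icc_subset_Icc_left h)

theorem brunovskyRank_zero (k : ℕ) (ρ : ℕ → ℕ) :
    brunovskyRank k ρ 0 = 1 + brunovskyVelocity k ρ 1 := by
  simp [brunovskyRank, brunovskyVelocity]

theorem brunovskyRank_succ (k : ℕ) (ρ : ℕ → ℕ) (j : ℕ) :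
    brunovskyRank k ρ (j + 1) = brunovskyRank k ρ j + brunovskyVelocity k ρ (j + 1) := by
  rw [brunovskyRank, Finset.sum_Icc_succ_top (by omega), ← add_assoc, brunovskyRank]

/-- The only signature with `m₀ ≤ 3` and `m₃ = m_k = 8` is `⟨0, 1, 1⟩`. -/
theorem brunovskyRank_eq_of_eight {k : ℕ} {ρ : ℕ → ℕ} (hk : 1 ≤ k)
    (h0 : brunovskyRank k ρ 0 ≤ 3) (hk8 : brunovskyRank k ρ k = 8)
    (h3 : 3 ≤ k → brunovskyRank k ρ 3 = 8) :
    3 ≤ k ∧ brunovskyRank k ρ 2 = 7 := by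
  have e0 := brunovskyRank_zero k ρ
  have e1 := brunovskyRank_succ k ρ 0
  have e2 := brunovskyRank_succ k ρ 1
  have e3 := brunovskyRank_succ k ρ 2
  have a1 := brunovskyVelocity_antitone k ρ (show 1 ≤ 2 by norm_num)
  have a2 := brunovskyVelocity_antitone k ρ (show 2 ≤ 3 by norm_num)
  norm_num at e1 e2 e3
  have hk3 : 3 ≤ k := by
    by_contra! hlt
    -- As every `Δᵢ` is at most 2, `m₁ ≤ 5` and `m₂ ≤ 7`, so 8 is not reached before step 3.
    interval_cases k <;> omega
  have := h3 hk3
  -- `8 = 1 + 2Δ₁ + Δ₂ + Δ₃` with `2 ≥ Δ₁ ≥ Δ₂ ≥ Δ₃` has the single solution `(2, 2, 1)`.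
  omega

/-! ### Fields on `M` whose images lie in a bundle on the orbit space. -/

/-- `X` is mapped by `dπ` into `D`, over `M`. -/
def LiftsTo {n m d : ℕ} {N : Type*} [TopologicalSpace N]
    [ChartedSpace (EuclideanSpace ℝ (Fin d)) N] (M : Set (TXU n m)) (π : TXU n m → N)
    (D : ∀ q : N, Submodule ℝ (TangentSpace (𝓡 d) q)) (X : TXU n m → TXU n m) : Prop :=
  ∀ p ∈ M, mfderiv 𝓘(ℝ, TXU n m) (𝓡 d) π p (X p) ∈ D (π p)

section LiftsTo

variable {n m d : ℕ} {N : Type*} [TopologicalSpace N]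
    [ChartedSpace (EuclideanSpace ℝ (Fin d)) N]
    {M : Set (TXU n m)} {π : TXU n m → N} {D : ∀ q : N, Submodule ℝ (TangentSpace (𝓡 d) q)}
    {X X' Y : TXU n m → TXU n m}

theorem LiftsTo.add (hX : LiftsTo M π D X) (hY : LiftsTo M π D Y) :
    LiftsTo M π D fun p => X p + Y p := fun p hp => by
  have h : mfderiv 𝓘(ℝ, TXU n m) (𝓡 d) π p (X p + Y p) =
      mfderiv 𝓘(ℝ, TXU n m) (𝓡 d) π p (X p) + mfderiv 𝓘(ℝ, TXU n m) (𝓡 d) π p (Y p) :=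
    map_add (mfderiv 𝓘(ℝ, TXU n m) (𝓡 d) π p) (X p) (Y p)
  rw [h]
  exact (D (π p)).add_mem (hX p hp) (hY p hp)

theorem LiftsTo.smul (a : TXU n m → ℝ) (hX : LiftsTo M π D X) :
    LiftsTo M π D fun p => a p • X p := fun p hp => by
  have h : mfderiv 𝓘(ℝ, TXU n m) (𝓡 d) π p (a p • X p) =
      a p • mfderiv 𝓘(ℝ, TXU n m) (𝓡 d) π p (X p) :=
    map_smul (mfderiv 𝓘(ℝ, TXU n m) (𝓡 d) π p) (a p) (X p)
  rw [h]
  exact (D (π p)).smul_mem _ (hX p hp)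

theorem LiftsTo.eventually (hM : IsOpen M) (hX : LiftsTo M π D X) {p : TXU n m} (hp : p ∈ M) :
    ∀ᶠ x in 𝓝 p, mfderiv 𝓘(ℝ, TXU n m) (𝓡 d) π x (X x) ∈ D (π x) :=
  Filter.mem_of_superset (hM.mem_nhds hp) fun x hx => hX x hx

theorem LiftsTo.lieBracket [IsManifold (𝓡 d) ∞ N] (hM : IsOpen M)
    (hπ : ContMDiffOn 𝓘(ℝ, TXU n m) (𝓡 d) ∞ π M) {r : ℕ} (hD : HasRank (𝓡 d) D r)
    (hs : HasLocalSections (𝓡 d) D) (hX : Differentiable ℝ X) (hX' : Differentiable ℝ X')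
    (h : LiftsTo M π D X) (h' : LiftsTo M π D X')
    (hY : ∀ p, VectorField.lieBracket ℝ X X' p = Y p) :
    LiftsTo M π (derivedDist (𝓡 d) D) Y := fun p hp => by
  rw [← hY]
  exact mfderiv_lieBracket_mem_derivedDist (hπ.contMDiffAt (hM.mem_nhds hp)) hD hs (hX p) (hX' p)
    (h.eventually hM hp) (h'.eventually hM hp)

theorem finrank_tangentSpace_euclidean (q : N) :
    Module.finrank ℝ (TangentSpace (𝓡 d) q) = d :=
  finrank_euclideanSpace_fin (𝕜 := ℝ) (n := d)

end LiftsTo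

/-- A bundle into which all the PVTOL fields are lifted is everything. -/
theorem eq_top_of_pvtol_liftsTo {h g lam : ℝ} (hlam : lam ≠ 0) {d : ℕ} {N : Type*}
    [TopologicalSpace N] [ChartedSpace (EuclideanSpace ℝ (Fin d)) N] {M : Set (TXU 6 2)}
    {π : TXU 6 2 → N} {D : ∀ q : N, Submodule ℝ (TangentSpace (𝓡 d) q)} {p : TXU 6 2}
    (hp : p ∈ M) (hsub : Function.Surjective (mfderiv 𝓘(ℝ, TXU 6 2) (𝓡 d) π p))
    (hT : LiftsTo M π D (pvtolT h g lam)) (hU : ∀ a, LiftsTo M π D fun _ => controlVec a)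
    (hB₁ : LiftsTo M π D pvtolB₁) (hB₂ : LiftsTo M π D (pvtolB₂ h lam))
    (hC₁ : LiftsTo M π D pvtolC₁) (hC₂ : LiftsTo M π D (pvtolC₂ h lam))
    (hE : LiftsTo M π D pvtolE) (hA : LiftsTo M π D pvtolA) : D (π p) = ⊤ := by
  let L : TXU 6 2 →ₗ[ℝ] TangentSpace (𝓡 d) (π p) :=
    (mfderiv 𝓘(ℝ, TXU 6 2) (𝓡 d) π p).toLinearMap
  have htop : (D (π p)).comap L = ⊤ := eq_top_of_pvtol_mem hlam (hT p hp) (hU 0 p hp) (hU 1 p hp)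
    (hB₁ p hp) (hB₂ p hp) (hC₁ p hp) (hC₂ p hp) (hE p hp) (hA p hp)
  refine eq_top_iff.2 fun w _ => ?_
  obtain ⟨v, rfl⟩ := hsub w
  have hall : ∀ v : TXU 6 2, v ∈ (D (π p)).comap L := fun v => htop ▸ Submodule.mem_top
  exact hall v

/-- If the bundle of the fields `T`, `B₁`, `B₂`, `C₁`, `C₂` has a corank two Cauchy bundle, then
it also contains the images of `E` and `A`. -/
theorem pvtol_liftsTo_of_finrank_cauchyDist {h g lam : ℝ} (hlam : lam ≠ 0) {d : ℕ} {N : Type*}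
    [TopologicalSpace N] [ChartedSpace (EuclideanSpace ℝ (Fin d)) N] [IsManifold (𝓡 d) ∞ N]
    {M : Set (TXU 6 2)} (hM : IsOpen M) {π : TXU 6 2 → N}
    (hπ : ContMDiffOn 𝓘(ℝ, TXU 6 2) (𝓡 d) ∞ π M)
    {D : ∀ q : N, Submodule ℝ (TangentSpace (𝓡 d) q)} {c : ℕ} (hD : HasRank (𝓡 d) D (c + 2))
    (hs : HasLocalSections (𝓡 d) D)
    (hc : HasRank (𝓡 d) (cauchyDist (𝓡 d) D) c)
    (hT : LiftsTo M π D (pvtolT h g lam))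
    (hB₁ : LiftsTo M π D pvtolB₁) (hB₂ : LiftsTo M π D (pvtolB₂ h lam))
    (hC₁ : LiftsTo M π D pvtolC₁) (hC₂ : LiftsTo M π D (pvtolC₂ h lam)) :
    LiftsTo M π D pvtolE ∧ LiftsTo M π D pvtolA := by
  have form : ∀ p ∈ M, ∀ μ : TangentSpace (𝓡 d) (π p) →ₗ[ℝ] ℝ, D (π p) ≤ LinearMap.ker μ →
      ∃ ν : TXU 6 2 →ₗ[ℝ] ℝ, (∀ v : TXU 6 2, ν v = μ (mfderiv 𝓘(ℝ, TXU 6 2) (𝓡 d) π p v)) ∧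
        ∀ X, LiftsTo M π D X → ν (X p) = 0 := by
    intro p hp μ hμ
    let L : TXU 6 2 →ₗ[ℝ] TangentSpace (𝓡 d) (π p) :=
      (mfderiv 𝓘(ℝ, TXU 6 2) (𝓡 d) π p).toLinearMap
    exact ⟨μ.comp L, fun v => rfl, fun X hX => hμ (hX p hp)⟩
  have hE : LiftsTo M π D pvtolE := by
    intro p hp
    by_contra hn
    obtain ⟨μ, hμE, hμ⟩ := Submodule.exists_le_ker_of_notMem hn
    obtain ⟨ν, hν, hν0⟩ := form p hp μ hμ
    -- The terms with `[B₁, B₂]` and `[B₁, C₁]` vanish, leaving `λE` against `−λE`.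
    have hpl := structure_plucker (hπ.contMDiffAt (hM.mem_nhds hp)) hD hs (hc _)
      (differentiable_pvtolB₁ p) (differentiable_pvtolC₂ h lam p) (differentiable_pvtolB₂ h lam p)
      (differentiable_pvtolC₁ p) (hB₁.eventually hM hp) (hC₂.eventually hM hp)
      (hB₂.eventually hM hp) (hC₁.eventually hM hp) μ hμ ν hν
    rw [lieBracket_B₁_C₂, lieBracket_B₂_C₁, lieBracket_B₁_B₂, lieBracket_B₁_C₁, map_zero,
      zero_mul, zero_mul, sub_zero, add_zero, map_neg, map_smul, smul_eq_mul, hν] at hpl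
    have : lam ^ 2 * μ (mfderiv 𝓘(ℝ, TXU 6 2) (𝓡 d) π p (pvtolE p)) ^ 2 = 0 := by
      linear_combination -hpl
    simp [hlam, hμE] at this
  refine ⟨hE, fun p hp => ?_⟩
  by_contra hn
  obtain ⟨μ, hμA, hμ⟩ := Submodule.exists_le_ker_of_notMem hn
  obtain ⟨ν, hν, hν0⟩ := form p hp μ hμ
  -- `E` is available as a field because it now lifts to `D`. Modulo `D`, `[T, E]` is `−A` and `[C₂,
  -- C₁]` is `λA`, while `[E, C₁]` and `[E, C₂]` vanish.
  have hpl := structure_plucker (hπ.contMDiffAt (hM.mem_nhds hp)) hD hs (hc _)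
    (differentiable_pvtolT h g lam p) (differentiable_pvtolE p) (differentiable_pvtolC₂ h lam p)
    (differentiable_pvtolC₁ p) (hT.eventually hM hp) (hE.eventually hM hp)
    (hC₂.eventually hM hp) (hC₁.eventually hM hp) μ hμ ν hν
  rw [lieBracket_T_E, lieBracket_C₂_C₁, lieBracket_E_C₁, lieBracket_E_C₂] at hpl
  simp only [map_sub, map_smul, map_neg, map_zero, smul_eq_mul, hν0 _ hB₁, mul_zero, zero_sub,
    sub_zero, neg_zero, add_zero] at hpl
  have : lam * μ (mfderiv 𝓘(ℝ, TXU 6 2) (𝓡 d) π p (pvtolA p)) ^ 2 = 0 := by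
    rw [← hν]
    linear_combination -hpl
  simp [hlam, hμA] at this

end GoursatTheory

end

/-! ### The contradiction. -/

open GoursatTheory
theorem mainTheorem10 (h g lam : ℝ) (hlam : lam ≠ 0)
    (M : Set (TXU 6 2)) (hMopen : IsOpen M) (hMne : M.Nonempty)
    (φ : ℝ → TXU 6 2 → TXU 6 2) (hφ : IsControlAdmissible (pvtol h g lam) M φ)
    (N : Type*) [TopologicalSpace N] [ChartedSpace (EuclideanSpace ℝ (Fin 8)) N]
    [IsManifold (𝓡 8) ∞ N]
    (π : TXU 6 2 → N) (hπ : IsOrbitSpace (d := 8) M φ π) :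
    ¬ IsGoursatBundle (𝓡 8) (quotientDist (d := 8) (controlDist (pvtol h g lam)) M π) := by
  rintro ⟨k, ρ, hG⟩
  obtain ⟨p₀, hp₀⟩ := hMne
  set D := quotientDist (d := 8) (controlDist (pvtol h g lam)) M π with hDdef
  have hs : ∀ j, HasLocalSections (𝓡 8) (derivedFlag (𝓡 8) D j) :=
    HasLocalSections.derivedFlag hG.totallyRegular.1.2
  have bracket : ∀ (j : ℕ) {X X' Y : TXU 6 2 → TXU 6 2}, Differentiable ℝ X →
      Differentiable ℝ X' → LiftsTo M π (derivedFlag (𝓡 8) D j) X →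
      LiftsTo M π (derivedFlag (𝓡 8) D j) X' → (∀ p, VectorField.lieBracket ℝ X X' p = Y p) →
      LiftsTo M π (derivedFlag (𝓡 8) D (j + 1)) Y := fun j X X' Y hX hX' hl hl' hY =>
    (hG.totallyRegular.2 j).1.elim fun r hr =>
      hl.lieBracket hMopen hπ.smooth hr (hs j) hX hX' hl' hY
  have up : ∀ (j : ℕ) {X : TXU 6 2 → TXU 6 2}, LiftsTo M π (derivedFlag (𝓡 8) D j) X →
      LiftsTo M π (derivedFlag (𝓡 8) D (j + 1)) X := fun j X hX p hp =>
    le_derivedDist _ _ (hX p hp)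
  have T0 : LiftsTo M π (derivedFlag (𝓡 8) D 0) (pvtolT h g lam) := fun p hp =>
    mfderiv_mem_quotientDist hp (pvtolT_mem_controlDist h g lam p)
  have U0 : ∀ a, LiftsTo M π (derivedFlag (𝓡 8) D 0) fun _ => controlVec a := fun a p hp =>
    mfderiv_mem_quotientDist hp (controlVec_mem_controlDist h g lam a p)
  have dT := differentiable_pvtolT h g lam
  have dB₁ := differentiable_pvtolB₁
  have dB₂ := differentiable_pvtolB₂ h lam
  have dC₁ := differentiable_pvtolC₁
  have dC₂ := differentiable_pvtolC₂ h lam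
  have T1 := up 0 T0
  have T2 := up 1 T1
  have U2 := fun a => up 1 (up 0 (U0 a))
  have B₁1 : LiftsTo M π (derivedFlag (𝓡 8) D 1) pvtolB₁ :=
    bracket 0 (differentiable_const _) dT (U0 0) T0 (lieBracket_control_zero_T h g lam)
  have B₂1 : LiftsTo M π (derivedFlag (𝓡 8) D 1) (pvtolB₂ h lam) :=
    bracket 0 (differentiable_const _) dT (U0 1) T0 (lieBracket_control_one_T h g lam)
  have B₁2 := up 1 B₁1
  have B₂2 := up 1 B₂1
  have C₁2 : LiftsTo M π (derivedFlag (𝓡 8) D 2) pvtolC₁ :=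
    bracket 1 dT dB₁ T1 B₁1 (lieBracket_T_B₁ h g lam)
  have C₂2 : LiftsTo M π (derivedFlag (𝓡 8) D 2) (pvtolC₂ h lam) := by
    -- This bracket is `h θ̇ B₁ − C₂`, so `C₂` is recovered by subtracting it from `h θ̇ B₁`.
    have h1 := bracket 1 dT dB₂ T1 B₂1 (lieBracket_T_B₂ h g lam)
    convert (B₁2.smul fun p => h * p.2.1 5).add (h1.smul fun _ => -1) using 1
    funext p
    module
  have E3 : LiftsTo M π (derivedFlag (𝓡 8) D 3) pvtolE := by
    convert (bracket 2 dB₁ dC₂ B₁2 C₂2 (lieBracket_B₁_C₂ h lam)).smul fun _ => lam⁻¹ using 1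
    funext p
    rw [inv_smul_smul₀ hlam]
  have A3 : LiftsTo M π (derivedFlag (𝓡 8) D 3) pvtolA := by
    convert ((bracket 2 dC₂ dC₁ C₂2 C₁2 (lieBracket_C₂_C₁ h lam)).add
      ((up 2 B₁2).smul fun p => lam * p.2.1 5)).smul fun _ => lam⁻¹ using 1
    funext p
    rw [sub_add_cancel, inv_smul_smul₀ hlam]
  have top3 : derivedFlag (𝓡 8) D 3 (π p₀) = ⊤ :=
    eq_top_of_pvtol_liftsTo hlam hp₀ (hπ.submersion p₀ hp₀) (up 2 T2) (fun a => up 2 (U2 a))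
      (up 2 B₁2) (up 2 B₂2) (up 2 C₁2) (up 2 C₂2) E3 A3
  have rank_of_top : ∀ j ≤ k, derivedFlag (𝓡 8) D j (π p₀) = ⊤ → brunovskyRank k ρ j = 8 := by
    intro j hj htop
    rw [← hG.rank_flag j hj (π p₀), htop, finrank_top, finrank_tangentSpace_euclidean]
  -- `D` is the image of a distribution spanned by three fields; the upper bound suffices for the
  -- numerics.
  have m0 : brunovskyRank k ρ 0 ≤ 3 := by
    rw [← hG.rank_flag 0 (Nat.zero_le k) (π p₀)]
    have : FiniteDimensional ℝ (TangentSpace (𝓡 8) (π p₀)) :=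
      inferInstanceAs (FiniteDimensional ℝ (EuclideanSpace ℝ (Fin 8)))
    have : FiniteDimensional ℝ (TangentSpace 𝓘(ℝ, TXU 6 2) p₀) :=
      inferInstanceAs (FiniteDimensional ℝ (TXU 6 2))
    exact (Submodule.finrank_mono (quotientDist_le_map hMopen hφ hπ hp₀)).trans
      ((Submodule.finrank_map_le _ _).trans (finrank_controlDist_le _ p₀))
  obtain ⟨hk3, m2⟩ := brunovskyRank_eq_of_eight hG.one_le m0
    (rank_of_top k le_rfl (hG.bracketGenerating _)) fun h3 => rank_of_top 3 h3 top3
  have m3 := rank_of_top 3 hk3 top3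
  have hD2 : HasRank (𝓡 8) (derivedFlag (𝓡 8) D 2) (5 + 2) := by
    have := hG.rank_flag 2 (by omega)
    rwa [m2] at this
  -- `2·7 − 8 − 1 = 5`, two less than the rank of `D⁽²⁾`.
  have hc : HasRank (𝓡 8) (cauchyDist (𝓡 8) (derivedFlag (𝓡 8) D 2)) 5 := by
    intro q
    have := hG.rank_cauchy 2 (by omega) q
    rw [m2, m3] at this
    omega
  obtain ⟨E2, A2⟩ := pvtol_liftsTo_of_finrank_cauchyDist hlam hMopen hπ.smooth hD2 (hs 2) hc
    T2 B₁2 B₂2 C₁2 C₂2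
  have := rank_of_top 2 (by omega) (eq_top_of_pvtol_liftsTo hlam hp₀ (hπ.submersion p₀ hp₀)
    T2 U2 B₁2 B₂2 C₁2 C₂2 E2 A2)
  omega
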